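/- Let $n,r\ge 0$ be integers with $n\ge 2r$, let $s\in\mathbb C$, let $\mathcal P_r=\{(\lambda_1,\dots,\lambda_r)\in\mathbb Z^r:\lambda_1\ge\dots\ge\lambda_r\ge 0\}$, and let $\lambda\in\mathcal P_r$. Put $\rho_i=\frac{n-(2i-1)}{2}$ for $1\le i\le n$. *Okounkov polynomials.* For a box $\mathfrak b=(i,j)$ of (the Young diagram of) a partition $\mu$ let $a_\mu(\mathfrak b)=\mu_i-j$, $l_\mu(\mathfrak b)=|\{k>i:\mu_k\ge j\}|$, $a'_\mu(\mathfrak b)=j-1$, $l'_\mu(\mathfrak b)=i-1$ and $$b_\mu(\mathfrak b;\tau)=\frac{a_\mu(\mathfrak b)+\tau(l_\mu(\mathfrak b)+1)}{a_\mu(\mathfrak b)+\tau l_\mu(\mathfrak b)+1}.$$ A reverse tableau $T$ of shape $\lambda$ is a filling of the boxes of $\lambda$ by elements of $\{1,\dots,r\}$ with weakly decreasing rows and strictly decreasing columns; $\lambda^{(k)}$ denotes the partition formed by the boxes with $T(\mathfrak b)>k$, and $$\Phi_T(\tau)=\prod_{k=1}^r\ \prod_{\mathfrak b}\frac{b_{\lambda^{(k)}}(\mathfrak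 b;\tau)}{b_{\lambda^{(k-1)}}(\mathfrak b;\tau)},$$ where $\mathfrak b$ runs over the boxes of $\lambda^{(k-1)}$ that lie in a row, but not in a column, meeting $\lambda^{(k-1)}\setminus\lambda^{(k)}$. The Okounkov type $BC_r$ interpolation polynomial is $$P_\lambda(x;\tau;\alpha)=\sum_T\Phi_T(\tau)\prod_{\mathfrak b\in\lambda}\Big(x_{T(\mathfrak b)}^2-\big(a'_\lambda(\mathfrak b)+\tau(r-T(\mathfrak b)-l'_\lambda(\mathfrak b))+\alpha\big)^2\Big),$$ the sum being over all reverse tableaux $T$ of shape $\lambda$. *Restricted Casimir polynomials.* The eigenvalue of the Casimir operator $C_p=\operatorname{tr}(\mathbf E^p)$ of $\mathfrak{gl}_n$ at the weight $(\lambda_1,\dots,\lambda_n)$ is $$c_p(\lambda_1,\dots,\lambda_n)=\sum_{i=1}^n\Big(\lambda_i+\rho_i+\tfrac{n-1}{2}\Big)^p\prod_{j\ne i}\Big(1-\frac{1}{\lambda_i-\lambda_j+\rho_i-\rho_j}\Big).$$ For $p\ge 0$ the restricted Casimir polynomial is $$C_p(x_1,\dots,x_r)=c_p(x_1,\dots,x_r,\underbrace{0,\dots,0}_{n-2r},-x_r,\dots,-x_1)\in\mathbb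 C[x_1,\dots,x_r],$$ and for $\mu\in\mathcal P_r$ put $C_{2\mu}=C_{2\mu_1}C_{2\mu_2}\cdots C_{2\mu_r}$ (here $C_0=n$ occurs once for every zero entry of $\mu$). **Proposition.** There is a unique family $(b_\mu)_{\mu\in\mathcal P_r}$ of complex numbers, only finitely many of them nonzero, such that $$P_\lambda\Big(x_1+\rho_1,\dots,x_r+\rho_r;\,1;\,s-\frac{n-1}{2}\Big)=\sum_{\mu\in\mathcal P_r}b_\mu\,C_{2\mu}(x_1,\dots,x_r)$$ as polynomials in $x_1,\dots,x_r$. -/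

import Mathlib

/-- Partitions `λ₁ ≥ ⋯ ≥ λ_r ≥ 0` with at most `r` parts, written as `r`-tuples padded by zeros
(the index set `𝒫_r`). The entry `λ_{i+1}` is `lam i`. -/
abbrev PartitionTuple (r : ℕ) : Type := {lam : Fin r → ℕ // Antitone lam}

/-! ### Okounkov type BC interpolation polynomials

Rows, columns and tableau entries are counted from `0` in the code: the box in row `i`, column `j`
below is the box `(i + 1, j + 1)` of the diagram, and the entry `k : Fin r` stands for `k + 1`. -/

section Okounkov

variable {r : ℕ}

/-- Fillings of the boxes of `lam` by entries from `{1, …, r}`. -/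
abbrev Filling (lam : Fin r → ℕ) : Type := (i : Fin r) → Fin (lam i) → Fin r

/-- Reverse tableaux: rows weakly decreasing, columns strictly decreasing. -/
def IsReverseTableau (lam : Fin r → ℕ) (T : Filling lam) : Prop :=
  (∀ (i : Fin r) (j j' : Fin (lam i)), j ≤ j' → T i j' ≤ T i j) ∧
  (∀ (i i' : Fin r) (j : Fin (lam i)) (j' : Fin (lam i')),
    i < i' → (j : ℕ) = (j' : ℕ) → T i' j' < T i j)

/-- The partition `λ⁽ᵏ⁾` formed by the boxes of `lam` whose entry (counted from `1`) is `> k`;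
its `i`-th part is the number of such boxes in row `i`. -/
def levelShape (lam : Fin r → ℕ) (T : Filling lam) (k : ℕ) : Fin r → ℕ :=
  fun i => (Finset.univ.filter fun j : Fin (lam i) => k < (T i j : ℕ) + 1).card

/-- Arm length `a_μ(b) = μ_i - j` of a box `b = (i, j)` of `μ` (no truncation occurs on boxes
of `μ`, the only place where it is used). -/
def armLength (mu : Fin r → ℕ) (i : Fin r) (j : ℕ) : ℕ := mu i - (j + 1)

/-- Leg length `l_μ(b) = #{k > i : μ_k ≥ j}` of a box `b = (i, j)`. -/
def legLength (mu : Fin r → ℕ) (i : Fin r) (j : ℕ) : ℕ :=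
  (Finset.univ.filter fun k : Fin r => i < k ∧ j + 1 ≤ mu k).card

/-- `b_μ(b; τ) = (a_μ(b) + τ (l_μ(b) + 1)) / (a_μ(b) + τ l_μ(b) + 1)`. -/
noncomputable def boxWeight (mu : Fin r → ℕ) (tau : ℂ) (i : Fin r) (j : ℕ) : ℂ :=
  ((armLength mu i j : ℂ) + tau * ((legLength mu i j : ℂ) + 1)) /
    ((armLength mu i j : ℂ) + tau * (legLength mu i j : ℂ) + 1)

/-- The row `i` of `μ` meets the skew diagram `μ \ ν`. -/
def RowMeets (mu nu : Fin r → ℕ) (i : Fin r) : Prop := nu i < mu i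

/-- The column `j` of `μ` meets the skew diagram `μ \ ν`. -/
def ColMeets (mu nu : Fin r → ℕ) (j : ℕ) : Prop := ∃ k : Fin r, nu k ≤ j ∧ j < mu k

open Classical in
/-- `Φ_T(τ) = ∏_{k=1}^{r} ∏_b b_{λ⁽ᵏ⁾}(b; τ) / b_{λ⁽ᵏ⁻¹⁾}(b; τ)`, where `b` runs over the boxes of
`λ⁽ᵏ⁻¹⁾` lying in a row, but not in a column, that meets `λ⁽ᵏ⁻¹⁾ \ λ⁽ᵏ⁾`. -/
noncomputable def tableauWeight (lam : Fin r → ℕ) (T : Filling lam) (tau : ℂ) : ℂ :=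
  ∏ k ∈ Finset.Icc 1 r, ∏ i : Fin r,
    ∏ j ∈ (Finset.range (levelShape lam T (k - 1) i)).filter fun j =>
        RowMeets (levelShape lam T (k - 1)) (levelShape lam T k) i ∧
          ¬ ColMeets (levelShape lam T (k - 1)) (levelShape lam T k) j,
      boxWeight (levelShape lam T k) tau i j / boxWeight (levelShape lam T (k - 1)) tau i j

open Classical in
/-- The Okounkov type BC interpolation polynomial
`P_λ(x; τ; α) = ∑_T Φ_T(τ) ∏_{b ∈ λ} (x_{T(b)}² - (a'_λ(b) + τ (r - T(b) - l'_λ(b)) + α)²)`,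
the sum over all reverse tableaux `T` of shape `λ` with entries in `{1, …, r}`. For the box `b` in
row `i`, column `j` (both counted from `0`), the arm co-length `a'_λ(b)` is `j`, the leg co-length
`l'_λ(b)` is `i`. -/
noncomputable def okounkovPolynomial (lam : PartitionTuple r) (tau alpha : ℂ) :
    MvPolynomial (Fin r) ℂ :=
  ∑ T ∈ Finset.univ.filter fun T : Filling lam.1 => IsReverseTableau lam.1 T,
    MvPolynomial.C (tableauWeight lam.1 T tau) *
      ∏ i : Fin r, ∏ j : Fin (lam.1 i),
        (MvPolynomial.X (T i j) ^ 2 -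
          MvPolynomial.C
            (((j : ℕ) : ℂ) + tau * ((r : ℂ) - (((T i j : ℕ) : ℂ) + 1) - ((i : ℕ) : ℂ)) + alpha)
              ^ 2)

end Okounkov

/-! ### Eigenvalues of Casimir operators of `𝔤𝔩_n` and their restriction -/

/-- The entry `ρ_{i+1} = (n - (2 (i+1) - 1)) / 2` of the half sum of positive roots. -/
def rhoEntry (K : Type*) [Field K] (n i : ℕ) : K := ((n : K) - (2 * ((i : K) + 1) - 1)) / 2

/-- The eigenvalue `c_p(λ) = ∑_i a_i (λ_i + ρ_i + (n-1)/2)^p`,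
`a_i = ∏_{j ≠ i} (1 - 1 / (λ_i - λ_j + ρ_i - ρ_j))`, of the Casimir operator
`C_p = tr (E^p)` of `𝔤𝔩_n` at the weight `λ`. -/
def casimirEigenvalue {K : Type*} [Field K] (n p : ℕ) (lam : Fin n → K) : K :=
  ∑ i : Fin n,
    (∏ j ∈ Finset.univ.erase i, (1 - 1 / (lam i - lam j + rhoEntry K n i - rhoEntry K n j))) *
      (lam i + rhoEntry K n i + ((n : K) - 1) / 2) ^ p

/-- The weight `x̃ = (x₁, …, x_r, 0, …, 0, -x_r, …, -x₁)` of length `n` (for `2 r ≤ n`). -/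
def tildeWeight {A : Type*} [AddGroup A] (n r : ℕ) (x : Fin r → A) : Fin n → A :=
  fun k =>
    if h : (k : ℕ) < r then x ⟨k, h⟩
    else if h' : n - r ≤ (k : ℕ) then - x ⟨n - 1 - k, by omega⟩
    else 0

section Polynomiality

open Polynomial in
/-- If the `l_i` are distinct elements of a domain, then `∑_i l_i^p ∏_{j ≠ i} (1 - 1/(l_i - l_j))`
lies in the domain. -/
theorem exists_algebraMap_eq_sum {R K : Type*} [CommRing R] [IsDomain R] [Field K] [Algebra R K]
    [IsFractionRing R K] (n p : ℕ) (l : Fin n → R) (hl : Function.Injective l) :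
    ∃ Q : R, algebraMap R K Q = ∑ i : Fin n,
      (∏ j ∈ Finset.univ.erase i, (1 - 1 / (algebraMap R K (l i) - algebraMap R K (l j)))) *
        algebraMap R K (l i) ^ p := by
  classical
  have hinj : Function.Injective (algebraMap R K) := IsFractionRing.injective R K
  set g : R[X] := Lagrange.nodal Finset.univ l with hg
  have hgm : g.Monic := Lagrange.nodal_monic
  set f : R[X] := X ^ p * ∏ j : Fin n, (X - C (l j + 1)) with hf
  set v : Fin n → K := fun i => algebraMap R K (l i) with hv
  have hvs : Set.InjOn v (Finset.univ : Finset (Fin n)) :=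
    fun a _ b _ h => hl (hinj h)
  have hdeg : ((f %ₘ g).map (algebraMap R K)).degree < (Finset.univ : Finset (Fin n)).card := by
    refine lt_of_le_of_lt degree_map_le ?_
    have := degree_modByMonic_lt f hgm
    rwa [hg, Lagrange.degree_nodal] at this
  have key := Lagrange.coeff_eq_sum hvs hdeg
  refine ⟨-((f %ₘ g).coeff ((Finset.univ : Finset (Fin n)).card - 1)), ?_⟩
  rw [map_neg, ← coeff_map, key, ← Finset.sum_neg_distrib]
  refine Finset.sum_congr rfl fun i hi => ?_
  have hev : ((f %ₘ g).map (algebraMap R K)).eval (v i) =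
      v i ^ p * ∏ j : Fin n, (v i - (v j + 1)) := by
    have h1 : (f %ₘ g).eval (l i) = f.eval (l i) := by
      conv_rhs => rw [← modByMonic_add_div f g]
      rw [eval_add, eval_mul, hg, Lagrange.eval_nodal_at_node (Finset.mem_univ i), zero_mul,
        add_zero]
    rw [hv, eval_map_apply, h1, hf]
    simp [eval_prod]
  rw [hev, ← Finset.mul_prod_erase Finset.univ _ (Finset.mem_univ i)]
  have hprod : ∏ j ∈ Finset.univ.erase i, (1 - 1 / (v i - v j)) =
      (∏ j ∈ Finset.univ.erase i, (v i - (v j + 1))) /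
        ∏ j ∈ Finset.univ.erase i, (v i - v j) := by
    rw [← Finset.prod_div_distrib]
    refine Finset.prod_congr rfl fun j hj => ?_
    have hne : v i - v j ≠ 0 := by
      rw [sub_ne_zero]
      exact fun h => (Finset.ne_of_mem_erase hj) (hl (hinj h)).symm
    field_simp
    ring
  change _ = (∏ j ∈ Finset.univ.erase i, (1 - 1 / (v i - v j))) * v i ^ p
  rw [hprod]
  ring

/-- The restriction of the Casimir eigenvalue `c_p` to the weights `x̃`, computed as a rational
function of the indeterminates `x₁, …, x_r`, is a polynomial. -/
theorem exists_restrictedCasimir (n r p : ℕ) :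
    ∃ Q : MvPolynomial (Fin r) ℂ,
      algebraMap (MvPolynomial (Fin r) ℂ) (FractionRing (MvPolynomial (Fin r) ℂ)) Q =
        casimirEigenvalue n p (tildeWeight n r fun i =>
          algebraMap (MvPolynomial (Fin r) ℂ) (FractionRing (MvPolynomial (Fin r) ℂ))
            (MvPolynomial.X i)) := by
  set K := FractionRing (MvPolynomial (Fin r) ℂ)
  set φ := algebraMap (MvPolynomial (Fin r) ℂ) K
  set l : Fin n → MvPolynomial (Fin r) ℂ := fun k =>
    tildeWeight n r MvPolynomial.X k + MvPolynomial.C ((n : ℂ) - 1 - (k : ℕ)) with hl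
  have hinj : Function.Injective l := by
    intro a b hab
    have h := congrArg (MvPolynomial.eval (fun _ : Fin r => (0 : ℂ))) hab
    have h0 : ∀ k : Fin n,
        MvPolynomial.eval (fun _ : Fin r => (0 : ℂ)) (tildeWeight n r MvPolynomial.X k) = 0 := by
      intro k
      unfold tildeWeight
      split_ifs <;> simp
    simp only [hl, map_add, h0, MvPolynomial.eval_C, zero_add] at h
    have h2 : ((a : ℕ) : ℂ) = ((b : ℕ) : ℂ) := by linear_combination -h
    exact Fin.ext (by exact_mod_cast h2)
  obtain ⟨Q, hQ⟩ := exists_algebraMap_eq_sum (K := K) n p l hinj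
  refine ⟨Q, hQ.trans ?_⟩
  have h2 : (2 : K) ≠ 0 := by
    have : φ (MvPolynomial.C (2 : ℂ)) ≠ 0 := by
      rw [Ne, map_eq_zero_iff φ (IsFractionRing.injective _ _)]
      simp
    simpa using this
  have ht : ∀ k : Fin n, φ (tildeWeight n r MvPolynomial.X k) =
      tildeWeight n r (fun i => φ (MvPolynomial.X i)) k := by
    intro k
    unfold tildeWeight
    split_ifs <;> simp
  have hlk : ∀ k : Fin n, φ (l k) = tildeWeight n r (fun i => φ (MvPolynomial.X i)) k +
      ((n : K) - 1 - (k : ℕ)) := by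
    intro k
    simp [hl, ht]
  unfold casimirEigenvalue
  refine Finset.sum_congr rfl fun i _ => ?_
  congr 1
  · refine Finset.prod_congr rfl fun j _ => ?_
    rw [hlk, hlk]
    congr 2
    unfold rhoEntry
    field_simp
    ring
  · rw [hlk]
    congr 1
    unfold rhoEntry
    field_simp
    ring

end Polynomiality

/-- The restricted Casimir polynomial
`C_p(x₁, …, x_r) = c_p(x₁, …, x_r, 0, …, 0, -x_r, …, -x₁)`: the polynomial equal to this
rational function (see `algebraMap_restrictedCasimir`). -/
noncomputable def restrictedCasimir (n r p : ℕ) : MvPolynomial (Fin r) ℂ :=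
  (exists_restrictedCasimir n r p).choose

theorem algebraMap_restrictedCasimir (n r p : ℕ) :
    algebraMap (MvPolynomial (Fin r) ℂ) (FractionRing (MvPolynomial (Fin r) ℂ))
        (restrictedCasimir n r p) =
      casimirEigenvalue n p (tildeWeight n r fun i =>
        algebraMap (MvPolynomial (Fin r) ℂ) (FractionRing (MvPolynomial (Fin r) ℂ))
          (MvPolynomial.X i)) :=
  (exists_restrictedCasimir n r p).choose_spec

/-- `C_λ = C_{λ₁} ⋯ C_{λ_r}` for a tuple `λ`. -/
noncomputable def restrictedCasimirProd (n r : ℕ) (lam : Fin r → ℕ) : MvPolynomial (Fin r) ℂ :=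
  ∏ i : Fin r, restrictedCasimir n r (lam i)

/-- `P_λ(x + ρ; 1; s - (n-1)/2)` as a polynomial in `x₁, …, x_r`, with
`ρ_i = (n - (2 i - 1)) / 2` for `1 ≤ i ≤ r`. -/
noncomputable def shiftedOkounkov (n r : ℕ) (s : ℂ) (lam : PartitionTuple r) :
    MvPolynomial (Fin r) ℂ :=
  MvPolynomial.aeval
    (fun i : Fin r =>
      (MvPolynomial.X i + MvPolynomial.C (rhoEntry ℂ n i) : MvPolynomial (Fin r) ℂ))
    (okounkovPolynomial lam 1 (s - ((n : ℂ) - 1) / 2))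

/-! In the variables `y = x + ρ` both sides live in the algebra `signedSymmetricSubalgebra r` of
polynomials invariant under permutations and sign changes. The proposition holds because the
products of Casimir polynomials form a basis of that algebra.

Okounkov side: at `τ = 1` all tableau weights are 1 and only squares of variables occur, so the
point is symmetry. It is a Bender–Knuth type argument: the tableaux that differ only by exchanging
entries `t` and `t + 1` are parametrized by an interlacing partition, the sum over it factors into
rows, and each row sum is symmetric by telescoping (`sum_interlacing_comm`,
`sum_mergeEntries_fiber`).

Casimir side: `C_p` depends only on the set of nodes, which in the variables `y` are `±y_i +
(n-1)/2` and constants, hence the invariance (`map_centeredCasimir_of_nodes`). Expanding `∏ (1 -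
1/(a - b))` turns `C_p` into a signed sum of divided differences of `t ^ p`; those with at least two
nodes have degree below `p` (`exists_dividedPower`). So `C_{2q}` has leading form `2 ∑ y_i ^ (2q)`
for `q > 0`, and `C_0 = n`.

Basis: an invariant polynomial is determined by its coefficients at the exponents `2ν` with `ν` a
partition. In the leading form of `C_{2μ}` the exponent `2ν` occurs only if `ν` arises by merging
parts of `μ`, which makes `ν` larger in dominance order. The coordinates are thus triangular with
nonzero diagonal, and `existsUnique_finsupp_of_triangular` concludes. -/

open MvPolynomial

/-! ### Symmetry of sums of factorial powers over interlacing partitions. -/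

section RowSums

variable {R : Type*} [CommRing R]

/-- The telescoping identity behind the symmetry of factorial complete homogeneous polynomials. -/
theorem sub_mul_sum_factorial_powers (A : ℕ → R) (m : ℕ) (u v : R) :
    (u - v) * ∑ k ∈ Finset.range (m + 1),
        (∏ j ∈ Finset.range k, (u - A j)) * ∏ j ∈ Finset.Ico k m, (v - A (j + 1)) =
      ∏ j ∈ Finset.range (m + 1), (u - A j) - ∏ j ∈ Finset.range (m + 1), (v - A j) := by
  induction m with
  | zero => simp
  | succ m ih =>
    have h : ∑ k ∈ Finset.range (m + 1),
          (∏ j ∈ Finset.range k, (u - A j)) * ∏ j ∈ Finset.Ico k (m + 1), (v - A (j + 1)) =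
        (∑ k ∈ Finset.range (m + 1),
          (∏ j ∈ Finset.range k, (u - A j)) * ∏ j ∈ Finset.Ico k m, (v - A (j + 1))) *
            (v - A (m + 1)) := by
      rw [Finset.sum_mul]
      refine Finset.sum_congr rfl fun k hk => ?_
      rw [Finset.prod_Ico_succ_top (by simpa [Nat.lt_succ_iff] using hk), mul_assoc]
    rw [Finset.sum_range_succ, h, Finset.Ico_self, Finset.prod_empty, mul_one, mul_add,
      ← mul_assoc, ih, Finset.prod_range_succ _ (m + 1), Finset.prod_range_succ _ (m + 1)]
    ring

/-- By the telescoping identity, `u - v` times the sum changes sign under exchange of `u` and `v`;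
in a domain the factor cancels. -/
theorem sum_factorial_powers_comm [IsDomain R] (A : ℕ → R) (m : ℕ) (u v : R) :
    ∑ k ∈ Finset.range (m + 1),
        (∏ j ∈ Finset.range k, (u - A j)) * ∏ j ∈ Finset.Ico k m, (v - A (j + 1)) =
      ∑ k ∈ Finset.range (m + 1),
        (∏ j ∈ Finset.range k, (v - A j)) * ∏ j ∈ Finset.Ico k m, (u - A (j + 1)) := by
  by_cases huv : u = v
  · rw [huv]
  · refine mul_left_cancel₀ (sub_ne_zero.2 huv) ?_
    rw [sub_mul_sum_factorial_powers, ← neg_sub v u, neg_mul, sub_mul_sum_factorial_powers, neg_sub]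

theorem sum_Icc_factorial_powers_comm [IsDomain R] (A : ℕ → R) (a b : ℕ) (u v : R) :
    ∑ k ∈ Finset.Icc a b,
        (∏ j ∈ Finset.Ico a k, (u - A j)) * ∏ j ∈ Finset.Ico k b, (v - A (j + 1)) =
      ∑ k ∈ Finset.Icc a b,
        (∏ j ∈ Finset.Ico a k, (v - A j)) * ∏ j ∈ Finset.Ico k b, (u - A (j + 1)) := by
  rcases le_or_gt a b with hab | hab
  · obtain ⟨m, rfl⟩ := Nat.exists_eq_add_of_le hab
    have key : ∀ u v : R, ∑ k ∈ Finset.Icc a (a + m),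
        (∏ j ∈ Finset.Ico a k, (u - A j)) * ∏ j ∈ Finset.Ico k (a + m), (v - A (j + 1)) =
        ∑ k ∈ Finset.range (m + 1),
          (∏ j ∈ Finset.range k, (u - A (a + j))) *
            ∏ j ∈ Finset.Ico k m, (v - A (a + (j + 1))) := by
      intro u v
      rw [← Finset.Ico_add_one_right_eq_Icc, Finset.sum_Ico_eq_sum_range,
        show a + m + 1 - a = m + 1 by omega]
      refine Finset.sum_congr rfl fun k _ => ?_
      rw [Finset.prod_Ico_eq_prod_range, Nat.add_sub_cancel_left]
      congr 1
      rw [add_comm a k, add_comm a m, ← Finset.prod_Ico_add']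
      exact Finset.prod_congr rfl fun j _ => by rw [show j + a + 1 = a + (j + 1) by ring]
    rw [key, key]
    exact sum_factorial_powers_comm (fun j => A (a + j)) m u v
  · simp [Finset.Icc_eq_empty (not_le.2 hab)]

/-- Lower end of the range of the `i`-th part of a partition interlacing with `nu ⊆ mu`. -/
def interlaceLower {m : ℕ} (mu nu : Fin (m + 1) → ℕ) (i : Fin (m + 1)) : ℕ :=
  Fin.lastCases (nu (Fin.last m)) (fun i => max (nu i.castSucc) (mu i.succ)) i

/-- Upper end of the range of the `i`-th part of a partition interlacing with `nu ⊆ mu`. -/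
def interlaceUpper {m : ℕ} (mu nu : Fin (m + 1) → ℕ) (i : Fin (m + 1)) : ℕ :=
  Fin.cases (mu 0) (fun i => min (mu i.succ) (nu i.castSucc)) i

theorem le_interlaceLower {m : ℕ} (mu nu : Fin (m + 1) → ℕ) (i : Fin (m + 1)) :
    nu i ≤ interlaceLower mu nu i := by
  induction i using Fin.lastCases <;> simp [interlaceLower]

theorem interlaceUpper_le {m : ℕ} (mu nu : Fin (m + 1) → ℕ) (i : Fin (m + 1)) :
    interlaceUpper mu nu i ≤ mu i := by
  induction i using Fin.cases <;> simp [interlaceUpper]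

/-- The boxes forced to be large pair off with the boxes forced to be small. -/
theorem prod_forced_eq {m : ℕ} (mu nu : Fin (m + 1) → ℕ) (B : ℕ → ℕ → R)
    (hB : ∀ i j, B (i + 1) (j + 1) = B i j) (v : R) :
    ∏ i : Fin (m + 1), ∏ j ∈ Finset.Ico (interlaceUpper mu nu i) (mu i), (v - B i (j + 1)) =
      ∏ i : Fin (m + 1), ∏ j ∈ Finset.Ico (nu i) (interlaceLower mu nu i), (v - B i j) := by
  rw [Fin.prod_univ_succ, Fin.prod_univ_castSucc]
  simp only [interlaceUpper, interlaceLower, Fin.cases_zero, Fin.cases_succ, Fin.lastCases_last,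
    Fin.lastCases_castSucc, Finset.Ico_self, Finset.prod_empty, one_mul, mul_one]
  refine Finset.prod_congr rfl fun i _ => ?_
  -- Both intervals consist of the columns where rows `i` and `i + 1` both meet the skew shape `mu \
  -- nu`; strictness down the column forces the two entries there.
  have : Finset.Ico (min (mu i.succ) (nu i.castSucc)) (mu i.succ) =
      Finset.Ico (nu i.castSucc) (max (nu i.castSucc) (mu i.succ)) := by
    ext; simp; omega
  rw [this]
  exact Finset.prod_congr rfl fun j _ => by rw [Fin.val_succ, hB, Fin.val_castSucc]

/-- For fixed `mu` and `nu` the bounds on `κ i` do not involve the other rows, so the sum is a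
product of row sums. The forced boxes contribute the same product once in `u` and once in `v`, and
each remaining row sum is symmetric. -/
theorem sum_interlacing_comm [IsDomain R] {m : ℕ} (mu nu : Fin (m + 1) → ℕ) (B : ℕ → ℕ → R)
    (hB : ∀ i j, B (i + 1) (j + 1) = B i j) (u v : R) :
    ∑ κ ∈ Fintype.piFinset fun i => Finset.Icc (interlaceLower mu nu i) (interlaceUpper mu nu i),
        ∏ i : Fin (m + 1), (∏ j ∈ Finset.Ico (nu i) (κ i), (u - B i j)) *
          ∏ j ∈ Finset.Ico (κ i) (mu i), (v - B i (j + 1)) =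
      ∑ κ ∈ Fintype.piFinset fun i => Finset.Icc (interlaceLower mu nu i) (interlaceUpper mu nu i),
        ∏ i : Fin (m + 1), (∏ j ∈ Finset.Ico (nu i) (κ i), (v - B i j)) *
          ∏ j ∈ Finset.Ico (κ i) (mu i), (u - B i (j + 1)) := by
  set lo := interlaceLower mu nu
  set hi := interlaceUpper mu nu
  have key : ∀ u v : R, ∑ κ ∈ Fintype.piFinset fun i => Finset.Icc (lo i) (hi i),
        ∏ i : Fin (m + 1), (∏ j ∈ Finset.Ico (nu i) (κ i), (u - B i j)) *
          ∏ j ∈ Finset.Ico (κ i) (mu i), (v - B i (j + 1)) =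
      (∏ i : Fin (m + 1), ∏ j ∈ Finset.Ico (nu i) (lo i), (u - B i j)) *
      (∏ i : Fin (m + 1), ∏ j ∈ Finset.Ico (nu i) (lo i), (v - B i j)) *
        ∏ i : Fin (m + 1), ∑ k ∈ Finset.Icc (lo i) (hi i),
          (∏ j ∈ Finset.Ico (lo i) k, (u - B i j)) * ∏ j ∈ Finset.Ico k (hi i), (v - B i (j + 1))
      := by
    intro u v
    rw [← prod_forced_eq mu nu B hB v, ← Finset.prod_mul_distrib, ← Finset.prod_mul_distrib,
      ← Finset.prod_univ_sum (fun i => Finset.Icc (lo i) (hi i)) fun i k =>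
        (∏ j ∈ Finset.Ico (nu i) k, (u - B i j)) * ∏ j ∈ Finset.Ico k (mu i), (v - B i (j + 1))]
    refine Finset.prod_congr rfl fun i _ => ?_
    rw [Finset.mul_sum]
    refine Finset.sum_congr rfl fun k hk => ?_
    rw [Finset.mem_Icc] at hk
    rw [← Finset.prod_Ico_consecutive _ (le_interlaceLower mu nu i) hk.1,
      ← Finset.prod_Ico_consecutive _ hk.2 (interlaceUpper_le mu nu i)]
    ring
  rw [key, key]
  congr 1
  · ring
  · exact Finset.prod_congr rfl fun i _ => sum_Icc_factorial_powers_comm (B i) _ _ u v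

end RowSums

/-! ### Redistributing two consecutive entries of a reverse tableau. -/

section TableauSymmetry

variable {r : ℕ}

/-- Identify the entries `t` and `t + 1` of a filling. -/
def mergeEntries {m : ℕ} (t : Fin m) {lam : Fin (m + 1) → ℕ} (T : Filling lam) : Filling lam :=
  fun i j => if T i j = t.succ then t.castSucc else T i j

/-- Redistribute the entries `t` and `t + 1` of a filling: in row `i` the columns before `κ i` get
`t + 1`, the others `t`. -/
def splitEntries {m : ℕ} (t : Fin m) {lam : Fin (m + 1) → ℕ} (T : Filling lam)
    (κ : Fin (m + 1) → ℕ) : Filling lam :=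
  fun i j => if T i j = t.castSucc ∨ T i j = t.succ then
    (if (j : ℕ) < κ i then t.succ else t.castSucc) else T i j

theorem levelShape_le (lam : Fin r → ℕ) (T : Filling lam) (k : ℕ) (i : Fin r) :
    levelShape lam T k i ≤ lam i := by
  unfold levelShape
  exact (Finset.card_le_univ _).trans (Fintype.card_fin _).le

theorem levelShape_eq_of_forall {lam : Fin r → ℕ} {T : Filling lam} {k : ℕ} {i : Fin r} {c : ℕ}
    (hc : c ≤ lam i) (h : ∀ j : Fin (lam i), k ≤ (T i j : ℕ) ↔ (j : ℕ) < c) :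
    levelShape lam T k i = c := by
  unfold levelShape
  have : (Finset.univ.filter fun j : Fin (lam i) => k < (T i j : ℕ) + 1) =
      Finset.univ.filter fun j : Fin (lam i) => (j : ℕ) < c := by
    ext j; simp [← h j]
  rw [this, Fin.card_filter_val_lt, min_eq_right hc]

/-- Rows decrease weakly, so the boxes with entry at least `k` (entries counted from 0) are an
initial segment of the row, and the level shape is its length. This turns later statements about
entries into inequalities between columns. -/
theorem IsReverseTableau.le_iff {lam : Fin r → ℕ} {T : Filling lam} (hT : IsReverseTableau lam T)
    (k : ℕ) (i : Fin r) (j : Fin (lam i)) : k ≤ (T i j : ℕ) ↔ (j : ℕ) < levelShape lam T k i := by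
  have hlow : IsLowerSet {j : Fin (lam i) | k ≤ (T i j : ℕ)} := fun a b hba ha =>
    le_trans ha (Fin.le_def.1 (hT.1 i b a hba))
  unfold levelShape
  constructor
  · intro h
    have hsub : Finset.univ.filter (fun j' : Fin (lam i) => (j' : ℕ) < j + 1) ⊆
        Finset.univ.filter fun j : Fin (lam i) => k < (T i j : ℕ) + 1 := by
      intro j' hj'
      simp only [Finset.mem_filter, Finset.mem_univ, true_and, Nat.lt_succ_iff] at hj' ⊢
      exact hlow (Fin.le_def.2 hj') h
    have := Finset.card_le_card hsub
    rw [Fin.card_filter_val_lt] at this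
    omega
  · intro h
    by_contra hk
    have hsub : (Finset.univ.filter fun j : Fin (lam i) => k < (T i j : ℕ) + 1) ⊆
        Finset.univ.filter (fun j' : Fin (lam i) => (j' : ℕ) < j) := by
      intro j' hj'
      simp only [Finset.mem_filter, Finset.mem_univ, true_and, Nat.lt_succ_iff] at hj' ⊢
      by_contra hle
      exact hk (hlow (Fin.le_def.2 (not_lt.1 hle)) hj')
    have := Finset.card_le_card hsub
    rw [Fin.card_filter_val_lt] at this
    omega

theorem levelShape_anti {lam : Fin r → ℕ} (T : Filling lam) {k k' : ℕ} (h : k ≤ k') (i : Fin r) :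
    levelShape lam T k' i ≤ levelShape lam T k i := by
  refine Finset.card_le_card fun j => ?_
  simp only [Finset.mem_filter, Finset.mem_univ, true_and]
  omega

/-- This is the interlacing of consecutive level shapes: a box with entry at least `k` has entries
at least `k + 1` above it. -/
theorem IsReverseTableau.levelShape_succ_le {lam : Fin r → ℕ} (hlam : Antitone lam)
    {T : Filling lam} (hT : IsReverseTableau lam T) (k : ℕ) {i i' : Fin r} (h : i < i') :
    levelShape lam T k i' ≤ levelShape lam T (k + 1) i := by
  by_contra! hlt
  have h1 := levelShape_le lam T k i'
  have h2 := hlam h.le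
  set j := levelShape lam T (k + 1) i with hj
  have h3 := (hT.le_iff k i' ⟨j, by omega⟩).2 hlt
  have h4 := Fin.lt_def.1 (hT.2 i i' ⟨j, by omega⟩ ⟨j, by omega⟩ h rfl)
  have h5 := (hT.le_iff (k + 1) i ⟨j, by omega⟩).1 (by omega)
  simp only [← hj] at h5
  omega

theorem IsReverseTableau.antitone_levelShape {lam : Fin r → ℕ} (hlam : Antitone lam)
    {T : Filling lam} (hT : IsReverseTableau lam T) (k : ℕ) : Antitone (levelShape lam T k) := by
  intro i i' h
  rcases h.eq_or_lt with rfl | h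
  · exact le_rfl
  · exact (hT.levelShape_succ_le hlam k h).trans (levelShape_anti T k.le_succ i)

variable {m : ℕ} {t : Fin m} {lam : Fin (m + 1) → ℕ}

theorem mergeEntries_eq_iff {T T' : Filling lam} :
    mergeEntries t T = mergeEntries t T' ↔ ∀ i j, T i j = T' i j ∨
      ((T i j = t.castSucc ∨ T i j = t.succ) ∧ (T' i j = t.castSucc ∨ T' i j = t.succ)) := by
  unfold mergeEntries
  constructor
  · intro h i j
    have := congrFun (congrFun h i) j
    grind
  · intro h
    funext i j
    have := h i j
    grind

theorem mergeEntries_splitEntries (T : Filling lam) (κ : Fin (m + 1) → ℕ) :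
    mergeEntries t (splitEntries t T κ) = mergeEntries t T := by
  rw [mergeEntries_eq_iff]
  intro i j
  unfold splitEntries
  grind

theorem levelShape_mem_piFinset (hlam : Antitone lam) {T T₀ : Filling lam}
    (hT : IsReverseTableau lam T) (h : mergeEntries t T = mergeEntries t T₀) :
    levelShape lam T (t + 1) ∈ Fintype.piFinset fun i =>
      Finset.Icc (interlaceLower (levelShape lam T₀ t) (levelShape lam T₀ (t + 2)) i)
        (interlaceUpper (levelShape lam T₀ t) (levelShape lam T₀ (t + 2)) i) := by
  rw [mergeEntries_eq_iff] at h
  -- Exchanging `t` and `t + 1` changes only the level shape that separates these two entries.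
  have hlev : ∀ k : ℕ, k ≠ t + 1 → levelShape lam T₀ k = levelShape lam T k := by
    intro k hk
    funext i
    refine levelShape_eq_of_forall (levelShape_le _ _ _ _) fun j => ?_
    rw [← hT.le_iff]
    have := h i j
    simp only [Fin.ext_iff, Fin.val_succ, Fin.val_castSucc] at this
    omega
  rw [hlev t (by omega), hlev (t + 2) (by omega), Fintype.mem_piFinset]
  intro i
  rw [Finset.mem_Icc]
  constructor
  · induction i using Fin.lastCases with
    | last => simpa [interlaceLower] using levelShape_anti T (by omega) _
    | cast i =>
      simp only [interlaceLower, Fin.lastCases_castSucc, max_le_iff]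
      exact ⟨levelShape_anti T (by omega) _, hT.levelShape_succ_le hlam _ Fin.castSucc_lt_succ⟩
  · induction i using Fin.cases with
    | zero => simpa [interlaceUpper] using levelShape_anti T (by omega) _
    | succ i =>
      simp only [interlaceUpper, Fin.cases_succ, le_min_iff]
      exact ⟨levelShape_anti T (by omega) _, hT.levelShape_succ_le hlam _ Fin.castSucc_lt_succ⟩

theorem interlaceLower_ge (mu nu : Fin (m + 1) → ℕ) (hmu : Antitone mu) {i i' : Fin (m + 1)}
    (h : i < i') : mu i' ≤ interlaceLower mu nu i := by
  induction i using Fin.lastCases with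
  | last => exact absurd h (not_lt.2 (Fin.le_last _))
  | cast i =>
    simp only [interlaceLower, Fin.lastCases_castSucc]
    exact (hmu (Fin.castSucc_lt_iff_succ_le.1 h)).trans (le_max_right _ _)

theorem interlaceUpper_le_of_lt (mu nu : Fin (m + 1) → ℕ) (hnu : Antitone nu) {i i' : Fin (m + 1)}
    (h : i < i') : interlaceUpper mu nu i' ≤ nu i := by
  induction i' using Fin.cases with
  | zero => exact absurd h (not_lt.2 (Fin.zero_le _))
  | succ i' =>
    simp only [interlaceUpper, Fin.cases_succ]
    exact (min_le_right _ _).trans (hnu (Fin.le_castSucc_iff.2 h))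

/-- If two boxes of one column carry `t` and `t + 1`, then `interlaceLower` puts the upper one
before `κ i` and `interlaceUpper` puts the lower one at or after `κ i'`, so the column stays strict.
-/
theorem isReverseTableau_splitEntries (hlam : Antitone lam) {T : Filling lam}
    (hT : IsReverseTableau lam T) {κ : Fin (m + 1) → ℕ}
    (hκ : κ ∈ Fintype.piFinset fun i =>
      Finset.Icc (interlaceLower (levelShape lam T t) (levelShape lam T (t + 2)) i)
        (interlaceUpper (levelShape lam T t) (levelShape lam T (t + 2)) i)) :
    IsReverseTableau lam (splitEntries t T κ) := by
  rw [Fintype.mem_piFinset] at hκ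
  constructor
  · intro i j j' hj
    have h := Fin.le_def.1 (hT.1 i j j' hj)
    have hj := Fin.le_def.1 hj
    rw [Fin.le_def]
    unfold splitEntries
    simp only [Fin.ext_iff, Fin.val_succ, Fin.val_castSucc]
    split_ifs <;> (try simp only [Fin.val_succ, Fin.val_castSucc]) <;> omega
  · intro i i' j j' hi hj
    have h := Fin.lt_def.1 (hT.2 i i' j j' hi hj)
    have h1 := (Finset.mem_Icc.1 (hκ i)).1
    have h2 := (Finset.mem_Icc.1 (hκ i')).2
    have h3 := interlaceLower_ge (levelShape lam T t) (levelShape lam T (t + 2))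
      (hT.antitone_levelShape hlam _) hi
    have h4 := interlaceUpper_le_of_lt (levelShape lam T t) (levelShape lam T (t + 2))
      (hT.antitone_levelShape hlam _) hi
    have h5 := hT.le_iff t i' j'
    have h6 := hT.le_iff (t + 2) i j
    rw [Fin.lt_def]
    unfold splitEntries
    simp only [Fin.ext_iff, Fin.val_succ, Fin.val_castSucc]
    split_ifs <;> (try simp only [Fin.val_succ, Fin.val_castSucc]) <;> omega

theorem splitEntries_levelShape {T T₀ : Filling lam} (hT : IsReverseTableau lam T)
    (h : mergeEntries t T = mergeEntries t T₀) :
    splitEntries t T₀ (levelShape lam T (t + 1)) = T := by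
  rw [mergeEntries_eq_iff] at h
  funext i j
  have h1 := h i j
  have h2 := hT.le_iff (t + 1) i j
  unfold splitEntries
  simp only [Fin.ext_iff, Fin.val_succ, Fin.val_castSucc] at h1 ⊢
  split_ifs <;> (try simp only [Fin.val_succ, Fin.val_castSucc]) <;> omega

theorem levelShape_splitEntries {T : Filling lam} (hT : IsReverseTableau lam T)
    {κ : Fin (m + 1) → ℕ}
    (h1 : ∀ i, levelShape lam T (t + 2) i ≤ κ i) (h2 : ∀ i, κ i ≤ levelShape lam T t i) :
    levelShape lam (splitEntries t T κ) (t + 1) = κ := by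
  funext i
  refine levelShape_eq_of_forall ((h2 i).trans (levelShape_le _ _ _ _)) fun j => ?_
  have h3 := hT.le_iff t i j
  have h4 := hT.le_iff (t + 2) i j
  have h1 := h1 i
  have h2 := h2 i
  unfold splitEntries
  simp only [Fin.ext_iff, Fin.val_succ, Fin.val_castSucc]
  split_ifs <;> (try simp only [Fin.val_succ, Fin.val_castSucc]) <;> omega

/-- The product of row weights of `splitEntries t T κ`. -/
theorem prod_splitEntries {R : Type*} [CommMonoid R] {T : Filling lam}
    (hT : IsReverseTableau lam T) {κ : Fin (m + 1) → ℕ} (i : Fin (m + 1))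
    (h1 : levelShape lam T (t + 2) i ≤ κ i) (h2 : κ i ≤ levelShape lam T t i)
    (w : ℕ → Fin (m + 1) → R) :
    ∏ j : Fin (lam i), w j (splitEntries t T κ i j) =
      (∏ j : Fin (lam i), if T i j = t.castSucc ∨ T i j = t.succ then 1 else w j (T i j)) *
      ((∏ j ∈ Finset.Ico (levelShape lam T (t + 2) i) (κ i), w j t.succ) *
        ∏ j ∈ Finset.Ico (κ i) (levelShape lam T t i), w j t.castSucc) := by
  have h3 := levelShape_le lam T t i
  set a := levelShape lam T (t + 2) i with ha
  set b := levelShape lam T t i with hb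
  have e1 : (∏ j ∈ Finset.Ico a (κ i), w j t.succ) * ∏ j ∈ Finset.Ico (κ i) b, w j t.castSucc =
      ∏ j : Fin (lam i), if a ≤ (j : ℕ) ∧ (j : ℕ) < b then
        (if (j : ℕ) < κ i then w j t.succ else w j t.castSucc) else 1 := by
    rw [← Finset.prod_range (fun j : ℕ => if a ≤ j ∧ j < b then
        (if j < κ i then w j t.succ else w j t.castSucc) else 1), ← Finset.prod_filter]
    have : (Finset.range (lam i)).filter (fun j => a ≤ j ∧ j < b) = Finset.Ico a b := by
      ext j; simp; omega
    rw [this, ← Finset.prod_Ico_consecutive _ h1 h2]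
    congr 1
    · exact Finset.prod_congr rfl fun j hj => by rw [if_pos (Finset.mem_Ico.1 hj).2]
    · exact Finset.prod_congr rfl fun j hj => by rw [if_neg (not_lt.2 (Finset.mem_Ico.1 hj).1)]
  rw [e1, ← Finset.prod_mul_distrib]
  refine Finset.prod_congr rfl fun j _ => ?_
  have h4 := hT.le_iff t i j
  have h5 := hT.le_iff (t + 2) i j
  have h6 : (T i j = t.castSucc ∨ T i j = t.succ) ↔ (a ≤ (j : ℕ) ∧ (j : ℕ) < b) := by
    simp only [Fin.ext_iff, Fin.val_succ, Fin.val_castSucc]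
    omega
  unfold splitEntries
  by_cases h7 : a ≤ (j : ℕ) ∧ (j : ℕ) < b
  · rw [if_pos (h6.2 h7), if_pos (h6.2 h7), if_pos h7, one_mul]
    split_ifs <;> rfl
  · rw [if_neg (mt h6.1 h7), if_neg (mt h6.1 h7), if_neg h7, mul_one]

end TableauSymmetry

/-! ### Symmetry and evenness of the Okounkov polynomial at `τ = 1`. -/

section OkounkovSymmetry

open Classical in
/-- The sum over the tableaux that agree with `T₀` up to exchanging entries `t` and `t + 1`. -/
theorem sum_mergeEntries_fiber {R : Type*} [CommSemiring R] {m : ℕ} (t : Fin m)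
    {lam : Fin (m + 1) → ℕ} (hlam : Antitone lam) {T₀ : Filling lam}
    (hT₀ : IsReverseTableau lam T₀) (w : Fin (m + 1) → ℕ → Fin (m + 1) → R) :
    ∑ T ∈ (Finset.univ.filter fun T : Filling lam => IsReverseTableau lam T).filter
        (fun T => mergeEntries t T = mergeEntries t T₀), ∏ i, ∏ j : Fin (lam i), w i j (T i j) =
      (∏ i, ∏ j : Fin (lam i),
        if T₀ i j = t.castSucc ∨ T₀ i j = t.succ then 1 else w i j (T₀ i j)) *
      ∑ κ ∈ Fintype.piFinset fun i =>
        Finset.Icc (interlaceLower (levelShape lam T₀ t) (levelShape lam T₀ (t + 2)) i)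
          (interlaceUpper (levelShape lam T₀ t) (levelShape lam T₀ (t + 2)) i),
        ∏ i, (∏ j ∈ Finset.Ico (levelShape lam T₀ (t + 2) i) (κ i), w i j t.succ) *
          ∏ j ∈ Finset.Ico (κ i) (levelShape lam T₀ t i), w i j t.castSucc := by
  rw [Finset.mul_sum]
  have hbd : ∀ κ ∈ (Fintype.piFinset fun i =>
      Finset.Icc (interlaceLower (levelShape lam T₀ t) (levelShape lam T₀ (t + 2)) i)
          (interlaceUpper (levelShape lam T₀ t) (levelShape lam T₀ (t + 2)) i)), ∀ i,
      levelShape lam T₀ (t + 2) i ≤ κ i ∧ κ i ≤ levelShape lam T₀ t i := by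
    intro κ hκ i
    have := Finset.mem_Icc.1 (Fintype.mem_piFinset.1 hκ i)
    exact ⟨(le_interlaceLower _ _ i).trans this.1, this.2.trans (interlaceUpper_le _ _ i)⟩
  -- A tableau of the fiber is determined by where each row passes from `t + 1` to `t`, that is, by
  -- its level shape at `t + 1`.
  refine Finset.sum_bij' (fun T _ => levelShape lam T (t + 1)) (fun κ _ => splitEntries t T₀ κ)
    ?_ ?_ ?_ ?_ ?_
  · intro T hT
    simp only [Finset.mem_filter, Finset.mem_univ, true_and] at hT
    exact levelShape_mem_piFinset hlam hT.1 hT.2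
  · intro κ hκ
    simp only [Finset.mem_filter, Finset.mem_univ, true_and]
    exact ⟨isReverseTableau_splitEntries hlam hT₀ hκ, mergeEntries_splitEntries _ _⟩
  · intro T hT
    simp only [Finset.mem_filter, Finset.mem_univ, true_and] at hT
    exact splitEntries_levelShape hT.1 hT.2
  · intro κ hκ
    exact levelShape_splitEntries hT₀ (fun i => (hbd κ hκ i).1) fun i => (hbd κ hκ i).2
  · intro T hT
    simp only [Finset.mem_filter, Finset.mem_univ, true_and] at hT
    have hκ := levelShape_mem_piFinset hlam hT.1 hT.2
    rw [← Finset.prod_mul_distrib]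
    conv_lhs => rw [← splitEntries_levelShape hT.1 hT.2]
    exact Finset.prod_congr rfl fun i _ =>
      prod_splitEntries hT₀ i (hbd _ hκ i).1 (hbd _ hκ i).2 (w i)

/-- At `τ = 1` the numerator and the denominator of `boxWeight` are both `a + l + 1`. -/
theorem tableauWeight_one {r : ℕ} (lam : Fin r → ℕ) (T : Filling lam) :
    tableauWeight lam T 1 = 1 := by
  have h : ∀ (mu : Fin r → ℕ) (i : Fin r) (j : ℕ), boxWeight mu 1 i j = 1 := by
    intro mu i j
    unfold boxWeight
    rw [one_mul, one_mul, ← add_assoc]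
    exact div_self (by exact_mod_cast Nat.succ_ne_zero (armLength mu i j + legLength mu i j))
  simp [tableauWeight, h]

/-- The factor of the box in row `i` and column `j` with entry `k` at `τ = 1`. -/
noncomputable def okounkovFactor {r : ℕ} (alpha : ℂ) (i : Fin r) (j : ℕ) (k : Fin r) :
    MvPolynomial (Fin r) ℂ :=
  X k ^ 2 - C (((j : ℂ) + ((r : ℂ) - (((k : ℕ) : ℂ) + 1) - ((i : ℕ) : ℂ)) + alpha) ^ 2)

open Classical in
theorem okounkovPolynomial_one {r : ℕ} (lam : PartitionTuple r) (alpha : ℂ) :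
    okounkovPolynomial lam 1 alpha =
      ∑ T ∈ Finset.univ.filter fun T : Filling lam.1 => IsReverseTableau lam.1 T,
        ∏ i, ∏ j : Fin (lam.1 i), okounkovFactor alpha i j (T i j) := by
  simp [okounkovPolynomial, okounkovFactor, tableauWeight_one]

theorem rename_swap_okounkovPolynomial {m : ℕ} (lam : PartitionTuple (m + 1)) (alpha : ℂ)
    (t : Fin m) :
    rename (Equiv.swap t.castSucc t.succ) (okounkovPolynomial lam 1 alpha) =
      okounkovPolynomial lam 1 alpha := by
  classical
  rw [okounkovPolynomial_one, ← Finset.sum_fiberwise _ (mergeEntries t), map_sum]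
  refine Finset.sum_congr rfl fun M _ => ?_
  rcases Finset.eq_empty_or_nonempty ((Finset.univ.filter fun T : Filling lam.1 =>
    IsReverseTableau lam.1 T).filter fun T => mergeEntries t T = M) with h | ⟨T₀, h⟩
  · rw [h]; simp
  simp only [Finset.mem_filter, Finset.mem_univ, true_and] at h
  obtain ⟨hT₀, rfl⟩ := h
  rw [sum_mergeEntries_fiber t lam.2 hT₀, map_mul]
  congr 1
  · simp only [map_prod]
    refine Finset.prod_congr rfl fun i _ => Finset.prod_congr rfl fun j _ => ?_
    split_ifs with h
    · simp
    · push Not at h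
      simp [okounkovFactor, Equiv.swap_apply_of_ne_of_ne h.1 h.2]
  -- `B i j` is the constant subtracted for the entry `t + 1`. Lowering the entry to `t` adds one
  -- inside the square, as does moving one column right, and `B` depends only on `j - i`.
  · set B : ℕ → ℕ → MvPolynomial (Fin (m + 1)) ℂ := fun i j =>
      C (((j : ℂ) + ((m : ℂ) - 1 - (t : ℕ) - (i : ℂ)) + alpha) ^ 2) with hB
    have h1 : ∀ (i : Fin (m + 1)) (j : ℕ),
        okounkovFactor alpha i j t.succ = X t.succ ^ 2 - B i j := by
      intro i j
      simp only [okounkovFactor, hB, Fin.val_succ]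
      congr 3
      push_cast
      ring
    have h2 : ∀ (i : Fin (m + 1)) (j : ℕ),
        okounkovFactor alpha i j t.castSucc = X t.castSucc ^ 2 - B i (j + 1) := by
      intro i j
      simp only [okounkovFactor, hB, Fin.val_castSucc]
      congr 3
      push_cast
      ring
    have h3 : ∀ i j, rename (Equiv.swap t.castSucc t.succ) (B i j) = B i j := fun i j =>
      rename_C _ _
    simp only [h1, h2, map_sum, map_prod, map_mul, map_sub, map_pow, rename_X, h3,
      Equiv.swap_apply_left, Equiv.swap_apply_right]
    refine sum_interlacing_comm _ _ B (fun i j => ?_) _ _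
    simp only [hB]
    push_cast
    ring_nf

theorem isSymmetric_okounkovPolynomial {r : ℕ} (lam : PartitionTuple r) (alpha : ℂ) :
    (okounkovPolynomial lam 1 alpha).IsSymmetric := by
  intro e
  cases r with
  | zero => rw [Subsingleton.elim e (Equiv.refl _)]; simp
  | succ m =>
    have he : e ∈ Submonoid.closure (Set.range fun i : Fin m => Equiv.swap i.castSucc i.succ) := by
      rw [Equiv.Perm.mclosure_swap_castSucc_succ]; trivial
    induction he using Submonoid.closure_induction with
    | mem e he =>
      obtain ⟨t, rfl⟩ := he
      exact rename_swap_okounkovPolynomial lam alpha t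
    | one => exact rename_id_apply _
    | mul e e' _ _ h h' => rw [Equiv.Perm.coe_mul, ← rename_rename, h', h]

/-- The automorphism changing the sign of the variable `X i`. -/
noncomputable def signFlip {r : ℕ} (i : Fin r) :
    MvPolynomial (Fin r) ℂ →ₐ[ℂ] MvPolynomial (Fin r) ℂ :=
  aeval fun k => if k = i then -X k else X k

theorem signFlip_okounkovPolynomial {r : ℕ} (lam : PartitionTuple r) (alpha : ℂ) (i : Fin r) :
    signFlip i (okounkovPolynomial lam 1 alpha) = okounkovPolynomial lam 1 alpha := by
  classical
  have h : ∀ (i' : Fin r) (j : ℕ) (k : Fin r),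
      signFlip i (okounkovFactor alpha i' j k) = okounkovFactor alpha i' j k := by
    intro i' j k
    simp only [okounkovFactor, signFlip, map_sub, map_pow, aeval_X, algHom_C,
      MvPolynomial.algebraMap_eq]
    split_ifs <;> simp
  simp [okounkovPolynomial_one, h]

end OkounkovSymmetry

/-! ### Polynomials modulo terms of lower degree. -/

section LowDegree

variable {σ : Type*}

/-- The polynomials of total degree less than `d` (only `0` if `d = 0`). -/
def degreeLtSubmodule (σ : Type*) (d : ℕ) : Submodule ℂ (MvPolynomial σ ℂ) where
  carrier := {f | ∀ m : σ →₀ ℕ, d ≤ m.degree → coeff m f = 0}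
  add_mem' {f g} hf hg m hm := by rw [coeff_add, hf m hm, hg m hm, add_zero]
  zero_mem' m _ := coeff_zero m
  smul_mem' c f hf m hm := by rw [coeff_smul, hf m hm, smul_zero]

theorem degreeLtSubmodule_mono {d e : ℕ} (h : d ≤ e) :
    degreeLtSubmodule σ d ≤ degreeLtSubmodule σ e :=
  fun _ hf m hm => hf m (h.trans hm)

/-- Strict bounds add up with a loss of one; putting `e + 1` on one factor avoids truncated
subtraction and keeps `d = 0` (where `f = 0`) included. -/
theorem mul_mem_degreeLtSubmodule {d e : ℕ} {f g : MvPolynomial σ ℂ}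
    (hf : f ∈ degreeLtSubmodule σ d) (hg : g ∈ degreeLtSubmodule σ (e + 1)) :
    f * g ∈ degreeLtSubmodule σ (d + e) := by
  classical
  intro m hm
  rw [coeff_mul]
  refine Finset.sum_eq_zero fun x hx => ?_
  rw [Finset.HasAntidiagonal.mem_antidiagonal] at hx
  have hdeg : x.1.degree + x.2.degree = m.degree := by rw [← hx, map_add]
  rcases le_or_gt d x.1.degree with h | h
  · rw [hf _ h, zero_mul]
  · rw [hg _ (by omega), mul_zero]

theorem IsHomogeneous.mem_degreeLtSubmodule {d : ℕ} {f : MvPolynomial σ ℂ}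
    (hf : f.IsHomogeneous d) : f ∈ degreeLtSubmodule σ (d + 1) :=
  fun m hm => hf.coeff_eq_zero (by omega)

theorem C_mem_degreeLtSubmodule (c : ℂ) : (C c : MvPolynomial σ ℂ) ∈ degreeLtSubmodule σ 1 :=
  IsHomogeneous.mem_degreeLtSubmodule (isHomogeneous_C σ c)

/-- If the `f i` have leading forms `g i`, their product has leading form `∏ i, g i`. -/
theorem prod_sub_prod_mem_degreeLtSubmodule {ι : Type*} (s : Finset ι) (d : ι → ℕ)
    (f g : ι → MvPolynomial σ ℂ) (hg : ∀ i ∈ s, (g i).IsHomogeneous (d i))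
    (h : ∀ i ∈ s, f i - g i ∈ degreeLtSubmodule σ (d i)) :
    ∏ i ∈ s, f i - ∏ i ∈ s, g i ∈ degreeLtSubmodule σ (∑ i ∈ s, d i) := by
  classical
  induction s using Finset.induction_on with
  | empty => simp
  | insert a s ha ih =>
    rw [Finset.prod_insert ha, Finset.prod_insert ha, Finset.sum_insert ha]
    have ih := ih (fun i hi => hg i (Finset.mem_insert_of_mem hi))
      fun i hi => h i (Finset.mem_insert_of_mem hi)
    have h1 := h a (Finset.mem_insert_self _ _)
    have h2 := IsHomogeneous.mem_degreeLtSubmodule (hg a (Finset.mem_insert_self _ _))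
    have h3 := IsHomogeneous.mem_degreeLtSubmodule
      (IsHomogeneous.prod s g d fun i hi => hg i (Finset.mem_insert_of_mem hi))
    have h4 : ∏ i ∈ s, f i ∈ degreeLtSubmodule σ (∑ i ∈ s, d i + 1) := by
      rw [← sub_add_cancel (∏ i ∈ s, f i) (∏ i ∈ s, g i)]
      exact add_mem (degreeLtSubmodule_mono (Nat.le_succ _) ih) h3
    have e : f a * ∏ i ∈ s, f i - g a * ∏ i ∈ s, g i =
        (f a - g a) * ∏ i ∈ s, f i + (∏ i ∈ s, f i - ∏ i ∈ s, g i) * g a := by ring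
    rw [e]
    refine add_mem (mul_mem_degreeLtSubmodule h1 h4) ?_
    rw [add_comm (d a)]
    exact mul_mem_degreeLtSubmodule ih h2

end LowDegree

/-! ### Casimir sums as signed sums of divided differences. -/

section DividedDifferences

variable {σ K : Type*} [DecidableEq σ] [Field K] [Algebra (MvPolynomial σ ℂ) K]

/-- The divided difference of `t ^ p` at the nodes `A`, in the fraction field. -/
noncomputable def dividedPower (K : Type*) [Field K] [Algebra (MvPolynomial σ ℂ) K] (p : ℕ)
    (A : Finset (MvPolynomial σ ℂ)) : K :=
  ∑ a ∈ A, algebraMap _ K a ^ p *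
    ∏ b ∈ A.erase a, (algebraMap (MvPolynomial σ ℂ) K a - algebraMap _ K b)⁻¹

/-- The Casimir sum `∑ a ^ p ∏ (1 - 1 / (a - b))` over the nodes `A`. -/
noncomputable def casimirSum (K : Type*) [Field K] [Algebra (MvPolynomial σ ℂ) K] (p : ℕ)
    (A : Finset (MvPolynomial σ ℂ)) : K :=
  ∑ a ∈ A, (∏ b ∈ A.erase a, (1 - 1 / (algebraMap (MvPolynomial σ ℂ) K a - algebraMap _ K b))) *
    algebraMap _ K a ^ p

/-- Expand each product over subsets `B` of the other nodes and collect the terms with the same `A =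
insert a B`. The empty `A` contributes an empty sum, so the truncated `A.card - 1` is harmless. -/
theorem casimirSum_eq_sum_dividedPower (p : ℕ) (S : Finset (MvPolynomial σ ℂ)) :
    casimirSum K p S = ∑ A ∈ S.powerset, (-1) ^ (A.card - 1) * dividedPower K p A := by
  unfold casimirSum dividedPower
  simp only [Finset.mul_sum]
  rw [Finset.sum_comm' (t' := S) (s' := fun a => S.powerset.filter fun A => a ∈ A) (by
    intro A a
    simp only [Finset.mem_powerset, Finset.mem_filter]
    exact ⟨fun h => ⟨h, h.1 h.2⟩, fun h => h.1⟩)]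
  refine Finset.sum_congr rfl fun a ha => ?_
  simp only [sub_eq_add_neg (1 : K), Finset.prod_one_add, Finset.sum_mul]
  refine Finset.sum_bij' (fun B _ => insert a B) (fun A _ => A.erase a) ?_ ?_ ?_ ?_ ?_
  · intro B hB
    rw [Finset.mem_powerset] at hB
    rw [Finset.mem_filter, Finset.mem_powerset]
    exact ⟨Finset.insert_subset ha (hB.trans (Finset.erase_subset _ _)), Finset.mem_insert_self _ _⟩
  · intro A hA
    rw [Finset.mem_filter, Finset.mem_powerset] at hA
    exact Finset.mem_powerset.2 (Finset.erase_subset_erase _ hA.1)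
  · intro B hB
    rw [Finset.mem_powerset] at hB
    exact Finset.erase_insert fun h => Finset.notMem_erase _ _ (hB h)
  · intro A hA
    exact Finset.insert_erase (Finset.mem_filter.1 hA).2
  · intro B hB
    rw [Finset.mem_powerset] at hB
    have haB : a ∉ B := fun h => Finset.notMem_erase _ _ (hB h)
    rw [Finset.card_insert_of_notMem haB, Finset.erase_insert haB, Nat.add_sub_cancel]
    simp only [one_div]
    rw [Finset.prod_neg]
    ring

variable [IsFractionRing (MvPolynomial σ ℂ) K]

/-- By Lagrange interpolation this is the coefficient of the constant polynomial 1 in degree `A.card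
- 1 > 0`. -/
theorem dividedPower_zero (A : Finset (MvPolynomial σ ℂ)) (hA : 2 ≤ A.card) :
    dividedPower K 0 A = 0 := by
  have hinj : Function.Injective (algebraMap (MvPolynomial σ ℂ) K) := IsFractionRing.injective _ _
  have h := Lagrange.coeff_eq_sum (s := A) (v := algebraMap (MvPolynomial σ ℂ) K)
    hinj.injOn (P := (1 : Polynomial K)) (by
      rw [Polynomial.degree_one]; exact_mod_cast (by omega : 0 < A.card))
  rw [Polynomial.coeff_one, if_neg (by omega)] at h
  rw [h, dividedPower]
  refine Finset.sum_congr rfl fun a _ => ?_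
  rw [pow_zero, one_mul, Polynomial.eval_one, one_div, Finset.prod_inv_distrib]

/-- Write `a = c + (a - c)`: the second summand cancels the denominator belonging to `c` and so
removes that node. -/
theorem dividedPower_succ (p : ℕ) (A : Finset (MvPolynomial σ ℂ)) {c : MvPolynomial σ ℂ}
    (hc : c ∈ A) : dividedPower K (p + 1) A =
      algebraMap _ K c * dividedPower K p A + dividedPower K p (A.erase c) := by
  have hinj : Function.Injective (algebraMap (MvPolynomial σ ℂ) K) := IsFractionRing.injective _ _
  unfold dividedPower
  rw [← sub_eq_iff_eq_add', Finset.mul_sum, ← Finset.sum_sub_distrib, ← Finset.add_sum_erase _ _ hc,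
    add_eq_right.2 (by ring)]
  refine Finset.sum_congr rfl fun a ha => ?_
  rw [Finset.mem_erase] at ha
  rw [Finset.erase_right_comm, ← Finset.mul_prod_erase (A.erase a) _
    (Finset.mem_erase.2 ⟨ha.1.symm, hc⟩)]
  have : algebraMap (MvPolynomial σ ℂ) K a - algebraMap _ K c ≠ 0 :=
    sub_ne_zero.2 (hinj.ne ha.1)
  field_simp
  ring

/-- The recursion in `p` shows that the denominators disappear and that a second node costs at least
one degree. When removing `c` leaves a single node `b`, the remaining term is `b ^ p`, still within
the bound for `p + 1`. -/
theorem exists_dividedPower (p : ℕ) : ∀ A : Finset (MvPolynomial σ ℂ), 2 ≤ A.card →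
    (∀ a ∈ A, a ∈ degreeLtSubmodule σ 2) →
    ∃ H ∈ degreeLtSubmodule σ p, algebraMap (MvPolynomial σ ℂ) K H = dividedPower K p A := by
  induction p with
  | zero =>
    intro A hA _
    exact ⟨0, zero_mem _, by rw [map_zero, dividedPower_zero A hA]⟩
  | succ p ih =>
    intro A hA hdeg
    obtain ⟨c, hc⟩ := Finset.card_pos.1 (by omega : 0 < A.card)
    obtain ⟨H, hH, hHe⟩ := ih A hA hdeg
    have hcard := Finset.card_erase_of_mem hc
    obtain ⟨H', hH', hHe'⟩ : ∃ H ∈ degreeLtSubmodule σ (p + 1),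
        algebraMap (MvPolynomial σ ℂ) K H = dividedPower K p (A.erase c) := by
      rcases lt_or_ge (A.erase c).card 2 with h | h
      · obtain ⟨b, hb⟩ := Finset.card_eq_one.1 (by omega : (A.erase c).card = 1)
        refine ⟨b ^ p, ?_, by simp [hb, dividedPower]⟩
        have hbA : b ∈ A := Finset.mem_of_mem_erase (hb ▸ Finset.mem_singleton_self b)
        have : ∀ k, b ^ k ∈ degreeLtSubmodule σ (k + 1) := by
          intro k
          induction k with
          | zero => simpa using C_mem_degreeLtSubmodule (σ := σ) 1
          | succ k ihk => exact pow_succ b k ▸ mul_mem_degreeLtSubmodule ihk (hdeg b hbA)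
        exact this p
      · obtain ⟨H', h1, h2⟩ := ih _ h fun a ha => hdeg a (Finset.mem_of_mem_erase ha)
        exact ⟨H', degreeLtSubmodule_mono (Nat.le_succ _) h1, h2⟩
    refine ⟨c * H + H', add_mem ?_ hH', by rw [map_add, map_mul, hHe, hHe', dividedPower_succ p A hc]⟩
    rw [mul_comm]
    exact mul_mem_degreeLtSubmodule hH (hdeg c hc)

/-- The Casimir sum is a polynomial with leading form `∑ a ^ p`. -/
theorem exists_casimirSum (p : ℕ) (S : Finset (MvPolynomial σ ℂ))
    (hS : ∀ a ∈ S, a ∈ degreeLtSubmodule σ 2) :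
    ∃ Q, algebraMap (MvPolynomial σ ℂ) K Q = casimirSum K p S ∧
      Q - ∑ a ∈ S, a ^ p ∈ degreeLtSubmodule σ p := by
  -- Only singletons `A` can contribute in degree `p`.
  have key : ∀ A ∈ S.powerset, ∃ Q, algebraMap (MvPolynomial σ ℂ) K Q =
      (-1) ^ (A.card - 1) * dividedPower K p A ∧
      Q - (if A.card = 1 then ∑ a ∈ A, a ^ p else 0) ∈ degreeLtSubmodule σ p := by
    intro A hA
    rw [Finset.mem_powerset] at hA
    rcases lt_trichotomy A.card 1 with h | h | h
    · rw [Nat.lt_one_iff, Finset.card_eq_zero] at h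
      exact ⟨0, by simp [h, dividedPower], by simp [h]⟩
    · obtain ⟨a, rfl⟩ := Finset.card_eq_one.1 h
      exact ⟨a ^ p, by simp [dividedPower], by simp⟩
    · obtain ⟨H, h1, h2⟩ := exists_dividedPower (K := K) p A h fun a ha => hS a (hA ha)
      refine ⟨(-1) ^ (A.card - 1) * H, by simp [h2], ?_⟩
      rw [if_neg (by omega), sub_zero]
      rcases neg_one_pow_eq_or (MvPolynomial σ ℂ) (A.card - 1) with h | h <;> rw [h]
      · simpa using h1
      · simpa using h1
  choose! Q hQ1 hQ2 using key
  refine ⟨∑ A ∈ S.powerset, Q A, ?_, ?_⟩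
  · rw [map_sum, casimirSum_eq_sum_dividedPower]
    exact Finset.sum_congr rfl hQ1
  · have : ∑ a ∈ S, a ^ p =
        ∑ A ∈ S.powerset, if A.card = 1 then ∑ a ∈ A, a ^ p else 0 := by
      rw [← Finset.sum_filter, ← Finset.powersetCard_eq_filter, Finset.powersetCard_one,
        Finset.sum_map]
      simp
    rw [this, ← Finset.sum_sub_distrib]
    exact Submodule.sum_mem _ hQ2

/-- Equivariance of Casimir sums under injective algebra endomorphisms. -/
theorem algebraMap_eq_casimirSum_image (e : MvPolynomial σ ℂ →ₐ[ℂ] MvPolynomial σ ℂ)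
    (he : Function.Injective e) {p : ℕ} {S : Finset (MvPolynomial σ ℂ)} {Q : MvPolynomial σ ℂ}
    (hQ : algebraMap (MvPolynomial σ ℂ) K Q = casimirSum K p S) :
    algebraMap (MvPolynomial σ ℂ) K (e Q) = casimirSum K p (S.image e) := by
  have hinj : Function.Injective ((algebraMap (MvPolynomial σ ℂ) K).comp (e : MvPolynomial σ ℂ →+* MvPolynomial σ ℂ)) :=
    (IsFractionRing.injective _ K).comp he
  have hE : ∀ f, IsFractionRing.lift hinj (algebraMap (MvPolynomial σ ℂ) K f) =
      algebraMap _ K (e f) := fun f => IsFractionRing.lift_algebraMap hinj f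
  rw [← hE, hQ]
  unfold casimirSum
  rw [Finset.sum_image he.injOn, map_sum]
  refine Finset.sum_congr rfl fun a _ => ?_
  rw [← Finset.image_erase he, Finset.prod_image he.injOn]
  simp only [map_mul, map_prod, map_sub, map_one, map_div₀, map_pow, hE]

end DividedDifferences

/-! ### Invariance and leading form of the Casimir polynomials in `y = x + ρ`. -/

section CenteredCasimir

/-- The nodes `x̃_k + ρ_k + (n - 1) / 2`. -/
noncomputable def casimirNode (n r : ℕ) (k : Fin n) : MvPolynomial (Fin r) ℂ :=
  tildeWeight n r X k + C ((n : ℂ) - 1 - (k : ℕ))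

/-- The nodes in the variables `y = x + ρ`. -/
noncomputable def centeredNode (n r : ℕ) (k : Fin n) : MvPolynomial (Fin r) ℂ :=
  tildeWeight n r X k +
    C (if (k : ℕ) < r ∨ n - r ≤ (k : ℕ) then ((n : ℂ) - 1) / 2 else (n : ℂ) - 1 - (k : ℕ))

theorem casimirNode_injective (n r : ℕ) : Function.Injective (casimirNode n r) := by
  intro a b hab
  have h := congrArg (eval (fun _ : Fin r => (0 : ℂ))) hab
  have h0 : ∀ k : Fin n, eval (fun _ : Fin r => (0 : ℂ)) (tildeWeight n r X k) = 0 := by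
    intro k
    unfold tildeWeight
    split_ifs <;> simp
  simp only [casimirNode, map_add, h0, eval_C, zero_add] at h
  have h2 : ((a : ℕ) : ℂ) = ((b : ℕ) : ℂ) := by linear_combination -h
  exact Fin.ext (by exact_mod_cast h2)

/-- The change of variables `x ↦ x + ρ`. -/
noncomputable def rhoShift (n r : ℕ) : MvPolynomial (Fin r) ℂ →ₐ[ℂ] MvPolynomial (Fin r) ℂ :=
  aeval fun i : Fin r => X i + C (rhoEntry ℂ n i)

/-- The change of variables `x ↦ x - ρ`. -/
noncomputable def rhoUnshift (n r : ℕ) : MvPolynomial (Fin r) ℂ →ₐ[ℂ] MvPolynomial (Fin r) ℂ :=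
  aeval fun i : Fin r => X i - C (rhoEntry ℂ n i)

theorem rhoShift_rhoUnshift (n r : ℕ) (f : MvPolynomial (Fin r) ℂ) :
    rhoShift n r (rhoUnshift n r f) = f := by
  have : (rhoShift n r).comp (rhoUnshift n r) = AlgHom.id ℂ _ := by
    ext i; simp [rhoShift, rhoUnshift]
  exact DFunLike.congr_fun this f

theorem rhoUnshift_rhoShift (n r : ℕ) (f : MvPolynomial (Fin r) ℂ) :
    rhoUnshift n r (rhoShift n r f) = f := by
  have : (rhoUnshift n r).comp (rhoShift n r) = AlgHom.id ℂ _ := by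
    ext i; simp [rhoShift, rhoUnshift]
  exact DFunLike.congr_fun this f

theorem rhoUnshift_injective (n r : ℕ) : Function.Injective (rhoUnshift n r) := by
  intro f g h
  rw [← rhoShift_rhoUnshift n r f, h, rhoShift_rhoUnshift]

/-- Since `ρ` changes sign under reversal of the indices, the shifts in the first and the last `r`
nodes both leave the constant `(n-1)/2`. -/
theorem rhoUnshift_casimirNode {n r : ℕ} (k : Fin n) :
    rhoUnshift n r (casimirNode n r k) = centeredNode n r k := by
  have hk := k.2
  unfold casimirNode centeredNode tildeWeight rhoUnshift
  by_cases h : (k : ℕ) < r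
  · simp only [h, dif_pos, true_or, if_true, map_add, aeval_X, algHom_C,
      MvPolynomial.algebraMap_eq]
    rw [sub_add_eq_add_sub, add_sub_assoc, ← C_sub, rhoEntry]
    congr 2
    ring
  · by_cases h' : n - r ≤ (k : ℕ)
    · simp only [h, h', dif_pos, or_true, if_true, map_add, map_neg, aeval_X, algHom_C,
        MvPolynomial.algebraMap_eq, dite_false]
      rw [neg_sub, sub_eq_neg_add, add_assoc, ← C_add, rhoEntry]
      congr 2
      have : ((n - 1 - (k : ℕ) : ℕ) : ℂ) = (n : ℂ) - 1 - (k : ℕ) := by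
        rw [Nat.cast_sub (by omega), Nat.cast_sub (by omega), Nat.cast_one]
      rw [this]
      ring
    · simp [h, h']

theorem centeredNode_injective (n r : ℕ) :
    Function.Injective (centeredNode n r) := by
  have h : centeredNode n r = rhoUnshift n r ∘ casimirNode n r :=
    funext fun k => (rhoUnshift_casimirNode k).symm
  rw [h]
  exact (rhoUnshift_injective n r).comp (casimirNode_injective n r)

theorem algebraMap_restrictedCasimir_eq_casimirSum (n r p : ℕ) :
    algebraMap _ (FractionRing (MvPolynomial (Fin r) ℂ)) (restrictedCasimir n r p) =
      casimirSum _ p (Finset.univ.image (casimirNode n r)) := by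
  rw [algebraMap_restrictedCasimir]
  set K := FractionRing (MvPolynomial (Fin r) ℂ)
  set φ := algebraMap (MvPolynomial (Fin r) ℂ) K
  have h2 : (2 : K) ≠ 0 := two_ne_zero
  have ht : ∀ k : Fin n, φ (tildeWeight n r X k) = tildeWeight n r (fun i => φ (X i)) k := by
    intro k
    unfold tildeWeight
    split_ifs <;> simp
  have hlk : ∀ k : Fin n, φ (casimirNode n r k) = tildeWeight n r (fun i => φ (X i)) k +
      ((n : K) - 1 - (k : ℕ)) := by
    intro k
    simp [casimirNode, ht]
  have hinj := casimirNode_injective n r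
  unfold casimirEigenvalue casimirSum
  rw [Finset.sum_image hinj.injOn]
  refine Finset.sum_congr rfl fun i _ => ?_
  rw [← Finset.image_erase hinj, Finset.prod_image hinj.injOn]
  congr 1
  · refine Finset.prod_congr rfl fun j _ => ?_
    rw [hlk, hlk]
    congr 2
    unfold rhoEntry
    field_simp
    ring
  · rw [hlk]
    congr 1
    unfold rhoEntry
    field_simp
    ring

/-- The restricted Casimir polynomial in the variables `y = x + ρ`. -/
noncomputable def centeredCasimir (n r p : ℕ) : MvPolynomial (Fin r) ℂ :=
  rhoUnshift n r (restrictedCasimir n r p)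

theorem algebraMap_centeredCasimir (n r p : ℕ) :
    algebraMap _ (FractionRing (MvPolynomial (Fin r) ℂ)) (centeredCasimir n r p) =
      casimirSum _ p (Finset.univ.image (centeredNode n r)) := by
  have himg : (Finset.univ.image (casimirNode n r)).image (rhoUnshift n r) =
      Finset.univ.image (centeredNode n r) := by
    rw [Finset.image_image]
    exact Finset.image_congr fun k _ => rhoUnshift_casimirNode k
  rw [← himg]
  exact algebraMap_eq_casimirSum_image (rhoUnshift n r) (rhoUnshift_injective n r)
    (algebraMap_restrictedCasimir_eq_casimirSum n r p)

/-- An injective endomorphism mapping the finite set of nodes into itself permutes it, and the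
Casimir sum sees only the set. -/
theorem map_centeredCasimir_of_nodes {n r : ℕ} (p : ℕ)
    (e : MvPolynomial (Fin r) ℂ →ₐ[ℂ] MvPolynomial (Fin r) ℂ) (he : Function.Injective e)
    (hnode : ∀ k, ∃ k', e (centeredNode n r k) = centeredNode n r k') :
    e (centeredCasimir n r p) = centeredCasimir n r p := by
  refine IsFractionRing.injective (MvPolynomial (Fin r) ℂ)
    (FractionRing (MvPolynomial (Fin r) ℂ)) ?_
  rw [algebraMap_eq_casimirSum_image e he (algebraMap_centeredCasimir n r p),
    algebraMap_centeredCasimir n r p]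
  congr 1
  refine Finset.eq_of_subset_of_card_le ?_ (Finset.card_image_of_injective _ he).ge
  intro f hf
  simp only [Finset.mem_image, Finset.mem_univ, true_and, exists_exists_eq_and] at hf ⊢
  obtain ⟨k, rfl⟩ := hf
  obtain ⟨k', h⟩ := hnode k
  exact ⟨k', h.symm⟩

theorem centeredNode_of_lt {n r : ℕ} (hn : 2 * r ≤ n) (i : Fin r) :
    centeredNode n r ⟨i, by omega⟩ = X i + C (((n : ℂ) - 1) / 2) := by
  simp [centeredNode, tildeWeight]

theorem centeredNode_of_ge {n r : ℕ} (hn : 2 * r ≤ n) (i : Fin r) :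
    centeredNode n r ⟨n - 1 - i, by omega⟩ = -X i + C (((n : ℂ) - 1) / 2) := by
  have hi := i.2
  have h1 : ¬ n - 1 - (i : ℕ) < r := by omega
  have h2 : n - r ≤ n - 1 - (i : ℕ) := by omega
  have h3 : n - 1 - (n - 1 - (i : ℕ)) = i := by omega
  simp [centeredNode, tildeWeight, h1, h2, h3]

theorem centeredNode_cases {n r : ℕ} (hn : 2 * r ≤ n) (k : Fin n) :
    (∃ i : Fin r, centeredNode n r k = X i + C (((n : ℂ) - 1) / 2)) ∨
    (∃ i : Fin r, centeredNode n r k = -X i + C (((n : ℂ) - 1) / 2)) ∨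
    ∃ c : ℂ, centeredNode n r k = C c := by
  have hk := k.2
  by_cases h : (k : ℕ) < r
  · exact Or.inl ⟨⟨k, h⟩, centeredNode_of_lt hn ⟨k, h⟩⟩
  · by_cases h' : n - r ≤ (k : ℕ)
    · refine Or.inr (Or.inl ⟨⟨n - 1 - k, by omega⟩, ?_⟩)
      rw [← centeredNode_of_ge hn]
      congr 1
      exact Fin.ext (by simp; omega)
    · exact Or.inr (Or.inr ⟨_, by rw [centeredNode, tildeWeight, dif_neg h, dif_neg h', zero_add]⟩)

theorem isSymmetric_centeredCasimir {n r : ℕ} (hn : 2 * r ≤ n) (p : ℕ) :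
    (centeredCasimir n r p).IsSymmetric := by
  intro e
  refine map_centeredCasimir_of_nodes p (rename e) (rename_injective e e.injective) ?_
  intro k
  rcases centeredNode_cases hn k with ⟨i, hi⟩ | ⟨i, hi⟩ | ⟨c, hc⟩
  · exact ⟨⟨e i, by omega⟩, by rw [hi, centeredNode_of_lt hn (e i)]; simp⟩
  · exact ⟨⟨n - 1 - e i, by omega⟩, by rw [hi, centeredNode_of_ge hn (e i)]; simp⟩
  · exact ⟨k, by rw [hc]; simp⟩

theorem signFlip_signFlip {r : ℕ} (i : Fin r) (f : MvPolynomial (Fin r) ℂ) :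
    signFlip i (signFlip i f) = f := by
  have : (signFlip i).comp (signFlip i) = AlgHom.id ℂ _ := by
    ext k : 1
    simp only [signFlip, AlgHom.comp_apply, aeval_X, AlgHom.id_apply]
    split_ifs with h <;> simp [h]
  exact DFunLike.congr_fun this f

/-- The sign change exchanges the nodes `y_i + (n-1)/2` and `-y_i + (n-1)/2` and fixes the others.
-/
theorem signFlip_centeredCasimir {n r : ℕ} (hn : 2 * r ≤ n) (p : ℕ) (i : Fin r) :
    signFlip i (centeredCasimir n r p) = centeredCasimir n r p := by
  refine map_centeredCasimir_of_nodes p (signFlip i)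
    (Function.LeftInverse.injective (g := signFlip i) (signFlip_signFlip i)) ?_
  intro k
  rcases centeredNode_cases hn k with ⟨j, hj⟩ | ⟨j, hj⟩ | ⟨c, hc⟩
  · rw [hj]
    by_cases h : j = i
    · exact ⟨_, by simpa [signFlip, h] using (centeredNode_of_ge hn i).symm⟩
    · exact ⟨_, by simpa [signFlip, h] using (centeredNode_of_lt hn j).symm⟩
  · rw [hj]
    by_cases h : j = i
    · exact ⟨_, by simpa [signFlip, h] using (centeredNode_of_lt hn i).symm⟩
    · exact ⟨_, by simpa [signFlip, h] using (centeredNode_of_ge hn j).symm⟩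
  · exact ⟨k, by rw [hc]; simp [signFlip]⟩

theorem isHomogeneous_tildeWeight (n r : ℕ) (k : Fin n) :
    (tildeWeight n r (X : Fin r → MvPolynomial (Fin r) ℂ) k).IsHomogeneous 1 := by
  unfold tildeWeight
  split_ifs
  · exact isHomogeneous_X _ _
  · exact (isHomogeneous_X _ _).neg
  · exact isHomogeneous_zero _ _ _

theorem centeredCasimir_sub_mem (n r p : ℕ) :
    centeredCasimir n r p - ∑ k : Fin n, tildeWeight n r X k ^ p ∈
      degreeLtSubmodule (Fin r) p := by
  have hconst : ∀ k, centeredNode n r k - tildeWeight n r X k ∈ degreeLtSubmodule (Fin r) 1 := by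
    intro k
    rw [centeredNode, add_sub_cancel_left]
    exact C_mem_degreeLtSubmodule _
  obtain ⟨Q, hQ, hdeg⟩ := exists_casimirSum (K := FractionRing (MvPolynomial (Fin r) ℂ)) p
    (Finset.univ.image (centeredNode n r)) (by
      intro a ha
      simp only [Finset.mem_image, Finset.mem_univ, true_and] at ha
      obtain ⟨k, rfl⟩ := ha
      rw [← sub_add_cancel (centeredNode n r k) (tildeWeight n r X k)]
      exact add_mem (degreeLtSubmodule_mono (by omega) (hconst k))
        (IsHomogeneous.mem_degreeLtSubmodule (isHomogeneous_tildeWeight n r k)))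
  have hQD : Q = centeredCasimir n r p := IsFractionRing.injective (MvPolynomial (Fin r) ℂ)
    (FractionRing (MvPolynomial (Fin r) ℂ)) (hQ.trans (algebraMap_centeredCasimir n r p).symm)
  rw [hQD, Finset.sum_image (centeredNode_injective n r).injOn] at hdeg
  rw [← sub_add_sub_cancel _ (∑ k, centeredNode n r k ^ p), ← Finset.sum_sub_distrib]
  refine add_mem hdeg (Submodule.sum_mem _ fun k _ => ?_)
  have := prod_sub_prod_mem_degreeLtSubmodule (Finset.range p) (fun _ => 1)
    (fun _ => centeredNode n r k) (fun _ => tildeWeight n r X k)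
    (fun _ _ => isHomogeneous_tildeWeight n r k) fun _ _ => hconst k
  simpa using this

/-- The coefficient of the power sum in the leading form of the Casimir polynomial. -/
noncomputable def casimirLeadingCoeff (n r q : ℕ) : ℂ := if q = 0 then (n : ℂ) / r else 2

theorem casimirLeadingCoeff_ne_zero {n r : ℕ} (hn : 2 * r ≤ n) (hr : 0 < r) (q : ℕ) :
    casimirLeadingCoeff n r q ≠ 0 := by
  unfold casimirLeadingCoeff
  split_ifs
  · exact div_ne_zero (by exact_mod_cast (by omega : n ≠ 0)) (by exact_mod_cast hr.ne')
  · exact two_ne_zero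

/-- For `q > 0` the zeros drop out and `±x_i` contribute equally, whence 2. For `q = 0` the left
side is `n` while the power sum is `r`, whence `n / r`; this lets zero parts of `μ` be treated like
all others. -/
theorem sum_tildeWeight_pow {n r : ℕ} (hn : 2 * r ≤ n) (hr : 0 < r) (q : ℕ) :
    ∑ k : Fin n, tildeWeight n r (X : Fin r → MvPolynomial (Fin r) ℂ) k ^ (2 * q) =
      C (casimirLeadingCoeff n r q) * ∑ i : Fin r, X i ^ (2 * q) := by
  unfold casimirLeadingCoeff
  rcases Nat.eq_zero_or_pos q with rfl | hq
  · have : (r : ℂ) ≠ 0 := by exact_mod_cast hr.ne'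
    simp only [mul_zero, pow_zero, Finset.sum_const, Finset.card_univ, Fintype.card_fin, if_true,
      nsmul_eq_mul, mul_one]
    rw [← map_natCast (C : ℂ →+* MvPolynomial (Fin r) ℂ) r, ← C_mul, div_mul_cancel₀ _ this,
      map_natCast]
  · obtain ⟨m, rfl⟩ : ∃ m, n = r + (m + r) := ⟨n - 2 * r, by omega⟩
    rw [if_neg hq.ne', Fin.sum_univ_add, Fin.sum_univ_add]
    have h1 : ∀ i : Fin r, tildeWeight (r + (m + r)) r
        (X : Fin r → MvPolynomial (Fin r) ℂ) (Fin.castAdd (m + r) i) = X i := by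
      intro i; simp [tildeWeight]
    have h2 : ∀ i : Fin m, tildeWeight (r + (m + r)) r
        (X : Fin r → MvPolynomial (Fin r) ℂ) (Fin.natAdd r (Fin.castAdd r i)) = 0 := by
      intro i
      have := i.2
      simp only [tildeWeight, Fin.val_natAdd, Fin.val_castAdd]
      rw [dif_neg (by omega), dif_neg (by omega)]
    have h3 : ∀ i : Fin r, tildeWeight (r + (m + r)) r
        (X : Fin r → MvPolynomial (Fin r) ℂ) (Fin.natAdd r (Fin.natAdd m i)) = -X i.rev := by
      intro i
      have := i.2
      simp only [tildeWeight, Fin.val_natAdd]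
      rw [dif_neg (by omega), dif_pos (by omega)]
      congr 2
      exact Fin.ext (by simp [Fin.val_rev]; omega)
    simp only [h1, h2, h3, (even_two_mul q).neg_pow]
    rw [zero_pow (by omega), Finset.sum_const_zero, zero_add,
      Fintype.sum_equiv Fin.revPerm (fun i : Fin r => (X i.rev : MvPolynomial (Fin r) ℂ) ^ (2 * q))
        (fun i => X i ^ (2 * q)) fun i => rfl]
    rw [map_ofNat, ← two_mul]

end CenteredCasimir

/-! ### Triangular families are bases. -/

section Triangular

/-- A family whose coordinates are triangular with nonzero diagonal is a basis. -/
theorem existsUnique_finsupp_of_triangular {P V β : Type*} [AddCommGroup V] [Module ℂ V]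
    [LinearOrder β] [WellFoundedLT β] (rank : P → β) (W : Submodule ℂ V) (Φ : V →ₗ[ℂ] P →₀ ℂ)
    (hΦ : ∀ f ∈ W, Φ f = 0 → f = 0) (B : P → V) (hB : ∀ μ, B μ ∈ W)
    (hdiag : ∀ μ, Φ (B μ) μ ≠ 0)
    (htri : ∀ μ ν, Φ (B μ) ν ≠ 0 → ν = μ ∨ rank ν < rank μ) (f : V) (hf : f ∈ W) :
    ∃! b : P →₀ ℂ, f = b.sum fun μ c => c • B μ := by
  classical
  have hsum : ∀ b : P →₀ ℂ, (b.sum fun μ c => c • B μ) ∈ W := fun b =>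
    Submodule.sum_mem _ fun μ _ => W.smul_mem _ (hB μ)
  -- Induction on the rank: `Φ (B μ)` is a nonzero multiple of the unit vector at `μ` plus unit
  -- vectors of smaller rank.
  have hspan : ∀ μ, Finsupp.single μ (1 : ℂ) ∈ Submodule.span ℂ (Set.range fun μ => Φ (B μ)) := by
    intro μ
    induction h : rank μ using WellFoundedLT.induction generalizing μ with
    | ind x ih =>
      subst h
      have h1 : Φ (B μ) = Finsupp.single μ (Φ (B μ) μ) +
          ((Φ (B μ)).erase μ).sum fun ν c => c • Finsupp.single ν (1 : ℂ) := by
        simp only [Finsupp.smul_single, smul_eq_mul, mul_one, Finsupp.sum_single]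
        exact (Finsupp.single_add_erase μ (Φ (B μ))).symm
      have h2 : (((Φ (B μ)).erase μ).sum fun ν c => c • Finsupp.single ν (1 : ℂ)) ∈
          Submodule.span ℂ (Set.range fun μ => Φ (B μ)) := by
        refine Submodule.sum_mem _ fun ν hν => Submodule.smul_mem _ _ ?_
        rw [Finsupp.support_erase, Finset.mem_erase, Finsupp.mem_support_iff] at hν
        exact ih _ ((htri μ ν hν.2).resolve_left hν.1) ν rfl
      have h3 : Finsupp.single μ (1 : ℂ) = (Φ (B μ) μ)⁻¹ • (Φ (B μ) -
          ((Φ (B μ)).erase μ).sum fun ν c => c • Finsupp.single ν (1 : ℂ)) := by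
        rw [sub_eq_of_eq_add h1, Finsupp.smul_single, smul_eq_mul, inv_mul_cancel₀ (hdiag μ)]
      rw [h3]
      exact Submodule.smul_mem _ _ (Submodule.sub_mem _ (Submodule.subset_span ⟨μ, rfl⟩) h2)
  have hmem : Φ f ∈ Submodule.span ℂ (Set.range fun μ => Φ (B μ)) := by
    rw [← Finsupp.sum_single (Φ f)]
    refine Submodule.sum_mem _ fun ν _ => ?_
    rw [← mul_one (Φ f ν), ← smul_eq_mul, ← Finsupp.smul_single]
    exact Submodule.smul_mem _ _ (hspan ν)
  obtain ⟨b, hb⟩ := Finsupp.mem_span_range_iff_exists_finsupp.1 hmem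
  have hΦsum : ∀ b : P →₀ ℂ, Φ (b.sum fun μ c => c • B μ) = b.sum fun μ c => c • Φ (B μ) := by
    intro b
    simp [Finsupp.sum, map_sum]
  have hex : f = b.sum fun μ c => c • B μ := by
    refine sub_eq_zero.1 (hΦ _ (W.sub_mem hf (hsum b)) ?_)
    rw [map_sub, hΦsum, hb, sub_self]
  have hindep : ∀ d : P →₀ ℂ, (d.sum fun μ c => c • B μ) = 0 → d = 0 := by
    intro d hd
    by_contra hne
    -- At an index of maximal rank in the support, no other member of the relation has a nonzero
    -- coordinate.
    obtain ⟨μ, hμ, hmax⟩ := Finset.exists_max_image d.support rank (Finsupp.support_nonempty_iff.2 hne)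
    have h1 := DFunLike.congr_fun (hΦsum d) μ
    rw [hd, map_zero, Finsupp.zero_apply, Finsupp.sum, Finsupp.finsetSum_apply,
      Finset.sum_eq_single μ] at h1
    · rw [Finsupp.smul_apply, smul_eq_mul] at h1
      exact mul_ne_zero (Finsupp.mem_support_iff.1 hμ) (hdiag μ) h1.symm
    · intro μ' hμ' hne'
      rw [Finsupp.smul_apply, smul_eq_mul]
      by_contra hnz
      rcases htri μ' μ (right_ne_zero_of_mul hnz) with h | h
      · exact hne' h.symm
      · exact (hmax μ' hμ').not_gt h
    · exact fun h => absurd hμ h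
  refine ⟨b, hex, fun b' hb' => ?_⟩
  rw [← sub_eq_zero]
  apply hindep
  rw [Finsupp.sum_sub_index fun μ x y => sub_smul x y (B μ), ← hb', ← hex, sub_self]

end Triangular

/-! ### Merging parts and dominance order. -/

section Dominance

variable {r : ℕ}

theorem sum_le_sum_head {ν : Fin r → ℕ} (hν : Antitone ν) (k : ℕ) {S : Finset (Fin r)}
    (hS : S.card = (Finset.univ.filter fun i : Fin r => (i : ℕ) < k).card) :
    ∑ i ∈ S, ν i ≤ ∑ i ∈ Finset.univ.filter fun i : Fin r => (i : ℕ) < k, ν i := by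
  set H := Finset.univ.filter fun i : Fin r => (i : ℕ) < k with hH
  -- The part at position `k` separates the head from the rest; for `k ≥ r` nothing lies outside the
  -- head and the value 0 serves.
  set c := if h : k < r then ν ⟨k, h⟩ else 0 with hc
  have h1 : ∀ i ∈ S \ H, ν i ≤ c := by
    intro i hi
    simp only [hH, Finset.mem_sdiff, Finset.mem_filter, Finset.mem_univ, true_and, not_lt] at hi
    rw [hc, dif_pos (hi.2.trans_lt i.2)]
    exact hν (Fin.le_def.2 hi.2)
  have h2 : ∀ i ∈ H \ S, c ≤ ν i := by
    intro i hi
    simp only [hH, Finset.mem_sdiff, Finset.mem_filter, Finset.mem_univ, true_and] at hi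
    rw [hc]
    split_ifs with h
    · exact hν (Fin.le_def.2 hi.1.le)
    · exact Nat.zero_le _
  rw [← Finset.sum_inter_add_sum_sdiff S H, ← Finset.sum_inter_add_sum_sdiff H S,
    Finset.inter_comm H S]
  refine Nat.add_le_add_left ?_ _
  calc ∑ i ∈ S \ H, ν i ≤ (S \ H).card • c := Finset.sum_le_card_nsmul _ _ _ h1
    _ = (H \ S).card • c := by rw [Finset.card_sdiff_comm hS]
    _ ≤ _ := Finset.card_nsmul_le_sum _ _ _ h2

/-- The tail sum `μ_k + μ_{k+1} + ⋯`. -/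
def tailSum (μ : Fin r → ℕ) (k : ℕ) : ℕ :=
  ∑ i ∈ Finset.univ.filter fun i : Fin r => ¬ (i : ℕ) < k, μ i

theorem eq_of_tailSum_eq {μ ν : Fin r → ℕ} (h : ∀ k ≤ r, tailSum ν k = tailSum μ k) : ν = μ := by
  have key : ∀ (μ : Fin r → ℕ) (i : Fin r), tailSum μ i = μ i + tailSum μ (i + 1) := by
    intro μ i
    unfold tailSum
    rw [← Finset.sum_insert (a := i) (by simp)]
    congr 1
    ext j
    simp [Fin.ext_iff]
    omega
  funext i
  have h1 := h i i.2.le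
  have h2 := h (i + 1) i.2
  rw [key, key μ] at h1
  omega

/-- Merging parts of a partition. -/
def IsMergeOf (g : Fin r → Fin r) (μ ν : Fin r → ℕ) : Prop :=
  ∀ j, ν j = ∑ i ∈ Finset.univ.filter fun i => g i = j, μ i

theorem IsMergeOf.sum_eq {g : Fin r → Fin r} {μ ν : Fin r → ℕ} (h : IsMergeOf g μ ν) :
    ∑ i, ν i = ∑ i, μ i := by
  rw [← Finset.sum_fiberwise Finset.univ g μ]
  exact Finset.sum_congr rfl fun j _ => h j

/-- The first `k` parts of `μ` go into at most `k` parts of `ν`, whose sum is at most that of the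
`k` largest. Head sums therefore grow under merging and, the total being fixed, tail sums shrink. -/
theorem IsMergeOf.tailSum_le {g : Fin r → Fin r} {μ ν : Fin r → ℕ} (h : IsMergeOf g μ ν)
    (hν : Antitone ν) (k : ℕ) : tailSum ν k ≤ tailSum μ k := by
  set H := Finset.univ.filter fun i : Fin r => (i : ℕ) < k with hH
  -- The map `g` need not be injective on `H`, so its image is padded to the cardinality of `H`.
  obtain ⟨S, hS, hcard⟩ := Finset.exists_superset_card_eq (s := H.image g) (n := H.card)
    Finset.card_image_le (Finset.card_le_univ _)
  have h1 : ∑ i ∈ H, μ i ≤ ∑ j ∈ S, ν j := by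
    calc ∑ i ∈ H, μ i = ∑ j ∈ S, ∑ i ∈ H with g i = j, μ i :=
          (Finset.sum_fiberwise_of_maps_to (fun i hi => hS (Finset.mem_image_of_mem g hi)) μ).symm
      _ ≤ ∑ j ∈ S, ν j := Finset.sum_le_sum fun j _ => by
          rw [h j]
          exact Finset.sum_le_sum_of_subset (Finset.filter_subset_filter _ (Finset.subset_univ _))
  have h2 : ∑ j ∈ S, ν j ≤ ∑ i ∈ H, ν i := sum_le_sum_head hν k hcard
  have h3 := h.sum_eq
  rw [← Finset.sum_filter_add_sum_filter_not Finset.univ (fun i : Fin r => (i : ℕ) < k) ν,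
    ← Finset.sum_filter_add_sum_filter_not Finset.univ (fun i : Fin r => (i : ℕ) < k) μ, ← hH] at h3
  unfold tailSum
  omega

/-- A rank function on partitions that refines size and, in each size, reverse dominance order. -/
def partitionRank (μ : Fin r → ℕ) : ℕ ×ₗ ℕ :=
  toLex (∑ i, μ i, ∑ k ∈ Finset.range (r + 1), tailSum μ k)

theorem IsMergeOf.eq_or_partitionRank_lt {g : Fin r → Fin r} {μ ν : Fin r → ℕ}
    (h : IsMergeOf g μ ν) (hν : Antitone ν) : ν = μ ∨ partitionRank ν < partitionRank μ := by
  by_cases heq : ∀ k ≤ r, tailSum ν k = tailSum μ k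
  · exact Or.inl (eq_of_tailSum_eq heq)
  · push Not at heq
    obtain ⟨k, hk, hne⟩ := heq
    refine Or.inr (Prod.Lex.toLex_lt_toLex.2 (Or.inr ⟨h.sum_eq, ?_⟩))
    exact Finset.sum_lt_sum (fun k _ => h.tailSum_le hν k)
      ⟨k, Finset.mem_range.2 (by omega), lt_of_le_of_ne (h.tailSum_le hν k) hne⟩

end Dominance

/-! ### Coordinates of signed symmetric polynomials, and the triangularity of the Casimir products.
-/

section SignedSymmetric

variable {r : ℕ}

/-- Polynomials invariant under permutations and sign changes of the variables. -/
noncomputable def signedSymmetricSubalgebra (r : ℕ) : Subalgebra ℂ (MvPolynomial (Fin r) ℂ) where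
  carrier := {f | f.IsSymmetric ∧ ∀ i, signFlip i f = f}
  mul_mem' hf hg := ⟨hf.1.mul hg.1, fun i => by rw [map_mul, hf.2, hg.2]⟩
  add_mem' hf hg := ⟨hf.1.add hg.1, fun i => by rw [map_add, hf.2, hg.2]⟩
  algebraMap_mem' c := ⟨IsSymmetric.C c, fun i => AlgHom.commutes _ c⟩

theorem coeff_signFlip (i : Fin r) (f : MvPolynomial (Fin r) ℂ) (m : Fin r →₀ ℕ) :
    coeff m (signFlip i f) = (-1) ^ m i * coeff m f := by
  have hmon : ∀ (a : Fin r →₀ ℕ) (c : ℂ),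
      signFlip i (monomial a c) = monomial a ((-1) ^ a i * c) := by
    intro a c
    have h : ∀ k : Fin r, (if k = i then -X k else X k : MvPolynomial (Fin r) ℂ) ^ a k =
        (if k = i then C ((-1) ^ a k) else 1) * X k ^ a k := by
      intro k
      split_ifs
      · rw [neg_pow]; simp
      · rw [one_mul]
    rw [signFlip, aeval_monomial, monomial_eq, Finsupp.prod_fintype _ _ (by simp),
      Finsupp.prod_fintype _ _ (by simp)]
    simp only [h]
    rw [Finset.prod_mul_distrib, Finset.prod_ite_eq' Finset.univ i, if_pos (Finset.mem_univ i),
      C_mul, MvPolynomial.algebraMap_eq]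
    ring
  induction f using MvPolynomial.induction_on' with
  | monomial a c =>
    rw [hmon, coeff_monomial, coeff_monomial]
    split_ifs with h
    · rw [h]
    · rw [mul_zero]
  | add p q hp hq => rw [map_add, coeff_add, coeff_add, hp, hq, mul_add]

/-- The exponent vector `2 ν`. -/
noncomputable def doubledExponent (ν : PartitionTuple r) : Fin r →₀ ℕ :=
  Finsupp.equivFunOnFinite.symm fun i => 2 * ν.1 i

theorem doubledExponent_apply (ν : PartitionTuple r) (i : Fin r) :
    doubledExponent ν i = 2 * ν.1 i := rfl

theorem doubledExponent_injective : Function.Injective (doubledExponent (r := r)) := by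
  intro μ ν h
  refine Subtype.ext (funext fun i => ?_)
  have := DFunLike.congr_fun h i
  rw [doubledExponent_apply, doubledExponent_apply] at this
  omega

theorem degree_doubledExponent (ν : PartitionTuple r) :
    (doubledExponent ν).degree = ∑ i, 2 * ν.1 i := by
  rw [Finsupp.degree_eq_sum]
  rfl

/-- The coefficients at the dominant even exponents. -/
noncomputable def dominantCoeff (r : ℕ) :
    MvPolynomial (Fin r) ℂ →ₗ[ℂ] PartitionTuple r →₀ ℂ where
  toFun f := Finsupp.ofSupportFinite (fun ν => coeff (doubledExponent ν) f)
    ((f.support.finite_toSet.preimage doubledExponent_injective.injOn).subset fun ν hν => by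
      simpa using hν)
  map_add' f g := Finsupp.ext fun ν => coeff_add _ f g
  map_smul' c f := Finsupp.ext fun ν => coeff_smul _ c f

theorem dominantCoeff_apply (f : MvPolynomial (Fin r) ℂ) (ν : PartitionTuple r) :
    dominantCoeff r f ν = coeff (doubledExponent ν) f := rfl

/-- A sign change kills every coefficient with an odd exponent, and a permutation sorts any even
exponent vector into a doubled partition. -/
theorem eq_zero_of_dominantCoeff_eq_zero {f : MvPolynomial (Fin r) ℂ}
    (hf : f ∈ signedSymmetricSubalgebra r) (h : dominantCoeff r f = 0) : f = 0 := by
  ext m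
  rw [coeff_zero]
  by_cases hm : ∀ i, Even (m i)
  · choose d hd using hm
    set σ := Tuple.sort (OrderDual.toDual ∘ d) with hσ
    have hanti : Antitone (d ∘ σ) := fun i j hij =>
      OrderDual.toDual_le_toDual.1 (Tuple.monotone_sort (OrderDual.toDual ∘ d) hij)
    have hmap : Finsupp.mapDomain σ.symm m = doubledExponent ⟨d ∘ σ, hanti⟩ := by
      ext i
      rw [Finsupp.mapDomain_equiv_apply, doubledExponent_apply, Equiv.symm_symm, hd]
      exact (two_mul _).symm
    rw [← coeff_rename_mapDomain σ.symm σ.symm.injective, hf.1 σ.symm, hmap, ← dominantCoeff_apply,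
      h, Finsupp.zero_apply]
  · push Not at hm
    obtain ⟨i, hi⟩ := hm
    have h1 := coeff_signFlip i f m
    rw [hf.2 i, (Nat.not_even_iff_odd.1 hi).neg_one_pow] at h1
    linear_combination h1 / 2

/-- Expansion of a product of multiples of even power sums into monomials. -/
theorem prod_powerSum_eq (c : Fin r → ℂ) (μ : Fin r → ℕ) :
    ∏ i, (C (c i) * ∑ j : Fin r, (X j : MvPolynomial (Fin r) ℂ) ^ (2 * μ i)) =
      C (∏ i, c i) * ∑ g : Fin r → Fin r,
        monomial (∑ i, Finsupp.single (g i) (2 * μ i)) (1 : ℂ) := by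
  rw [Finset.prod_mul_distrib, Finset.prod_univ_sum, map_prod, Fintype.piFinset_univ]
  congr 1
  refine Finset.sum_congr rfl fun g _ => ?_
  rw [monomial_sum_one]
  exact Finset.prod_congr rfl fun i _ => X_pow_eq_monomial

/-- Here `g` records which variable is chosen from each power sum; choosing the same variable twice
merges the two parts. -/
theorem sum_single_eq_doubledExponent_iff {g : Fin r → Fin r} {μ ν : PartitionTuple r} :
    ∑ i, Finsupp.single (g i) (2 * μ.1 i) = doubledExponent ν ↔ IsMergeOf g μ.1 ν.1 := by
  unfold IsMergeOf
  rw [DFunLike.ext_iff]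
  refine forall_congr' fun j => ?_
  rw [Finsupp.finsetSum_apply, doubledExponent_apply, Finset.sum_filter]
  have : ∀ i, Finsupp.single (g i) (2 * μ.1 i) j = 2 * if g i = j then μ.1 i else 0 := by
    intro i
    rw [Finsupp.single_apply]
    split_ifs <;> rfl
  simp only [this, ← Finset.mul_sum]
  omega

variable {n : ℕ}

/-- The products of Casimir polynomials in the variables `y = x + ρ`. -/
noncomputable def centeredCasimirProd (n r : ℕ) (μ : PartitionTuple r) :
    MvPolynomial (Fin r) ℂ :=
  ∏ i, centeredCasimir n r (2 * μ.1 i)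

theorem centeredCasimirProd_mem (hn : 2 * r ≤ n) (μ : PartitionTuple r) :
    centeredCasimirProd n r μ ∈ signedSymmetricSubalgebra r :=
  Subalgebra.prod_mem _ fun _ _ =>
    ⟨isSymmetric_centeredCasimir hn _, fun j => signFlip_centeredCasimir hn _ j⟩

open Classical in
-- The size condition places `2ν` in degree at least that of the leading form, so the lower terms do
-- not contribute and the coefficient counts mergings of `μ` into `ν`.
theorem coeff_centeredCasimirProd (hn : 2 * r ≤ n) (μ ν : PartitionTuple r)
    (h : ∑ i, μ.1 i ≤ ∑ i, ν.1 i) :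
    coeff (doubledExponent ν) (centeredCasimirProd n r μ) =
      (∏ i, casimirLeadingCoeff n r (μ.1 i)) *
        (Finset.univ.filter fun g : Fin r → Fin r => IsMergeOf g μ.1 ν.1).card := by
  have h1 : ∀ i ∈ Finset.univ, (C (casimirLeadingCoeff n r (μ.1 i)) *
      ∑ j : Fin r, (X j : MvPolynomial (Fin r) ℂ) ^ (2 * μ.1 i)).IsHomogeneous (2 * μ.1 i) := by
    intro i _
    rw [← zero_add (2 * μ.1 i)]
    refine (isHomogeneous_C _ _).mul (IsHomogeneous.sum _ _ _ fun j _ => ?_)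
    simpa using (isHomogeneous_X ℂ j).pow (2 * μ.1 i)
  have h2 := prod_sub_prod_mem_degreeLtSubmodule Finset.univ (fun i => 2 * μ.1 i)
    (fun i => centeredCasimir n r (2 * μ.1 i)) _ h1 (by
      intro i _
      rw [← sum_tildeWeight_pow hn i.pos]
      exact centeredCasimir_sub_mem n r _)
  have h3 := h2 (doubledExponent ν) (by
    rw [degree_doubledExponent, ← Finset.mul_sum, ← Finset.mul_sum]; omega)
  rw [coeff_sub, sub_eq_zero] at h3
  rw [centeredCasimirProd, h3, prod_powerSum_eq, coeff_C_mul, coeff_sum]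
  simp only [coeff_monomial, sum_single_eq_doubledExponent_iff]
  rw [Finset.sum_boole]

theorem dominantCoeff_centeredCasimirProd_self (hn : 2 * r ≤ n) (μ : PartitionTuple r) :
    dominantCoeff r (centeredCasimirProd n r μ) μ ≠ 0 := by
  classical
  rw [dominantCoeff_apply, coeff_centeredCasimirProd hn μ μ le_rfl]
  refine mul_ne_zero (Finset.prod_ne_zero_iff.2 fun i _ =>
    casimirLeadingCoeff_ne_zero hn i.pos _) ?_
  rw [Nat.cast_ne_zero, Finset.card_ne_zero]
  -- The identity merges nothing, so the count is positive.
  refine ⟨id, Finset.mem_filter.2 ⟨Finset.mem_univ _, fun j => ?_⟩⟩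
  simp [Finset.sum_filter]

theorem eq_or_partitionRank_lt_of_dominantCoeff_ne_zero (hn : 2 * r ≤ n) (μ ν : PartitionTuple r)
    (h : dominantCoeff r (centeredCasimirProd n r μ) ν ≠ 0) :
    ν = μ ∨ partitionRank ν.1 < partitionRank μ.1 := by
  classical
  rcases lt_or_ge (∑ i, ν.1 i) (∑ i, μ.1 i) with hlt | hge
  · exact Or.inr (Prod.Lex.toLex_lt_toLex.2 (Or.inl hlt))
  · rw [dominantCoeff_apply, coeff_centeredCasimirProd hn μ ν hge] at h
    obtain ⟨g, hg⟩ := Finset.card_ne_zero.1 (Nat.cast_ne_zero.1 (right_ne_zero_of_mul h))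
    rw [Subtype.ext_iff]
    exact (Finset.mem_filter.1 hg).2.eq_or_partitionRank_lt ν.2

end SignedSymmetric

theorem mainTheorem3 (n r : ℕ) (hn : 2 * r ≤ n) (s : ℂ) (lam : PartitionTuple r) :
    ∃! b : PartitionTuple r →₀ ℂ,
      shiftedOkounkov n r s lam =
        b.sum fun mu c => c • restrictedCasimirProd n r (fun i => 2 * mu.1 i) := by
  have key := existsUnique_finsupp_of_triangular (fun μ : PartitionTuple r => partitionRank μ.1)
    (Subalgebra.toSubmodule (signedSymmetricSubalgebra r)) (dominantCoeff r)
    (fun f hf => eq_zero_of_dominantCoeff_eq_zero hf) (centeredCasimirProd n r)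
    (centeredCasimirProd_mem hn) (dominantCoeff_centeredCasimirProd_self hn)
    (eq_or_partitionRank_lt_of_dominantCoeff_ne_zero hn)
    (okounkovPolynomial lam 1 (s - ((n : ℂ) - 1) / 2))
    ⟨isSymmetric_okounkovPolynomial lam _, signFlip_okounkovPolynomial lam _⟩
  refine (existsUnique_congr fun b => ?_).1 key
  -- The expansion in `y` is carried back to `x` by the injective substitution `rhoShift`.
  rw [← (Function.LeftInverse.injective (g := rhoUnshift n r) (rhoUnshift_rhoShift n r)).eq_iff,
    show shiftedOkounkov n r s lam = rhoShift n r (okounkovPolynomial lam 1 _) from rfl]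
  have : rhoShift n r (b.sum fun μ c => c • centeredCasimirProd n r μ) =
      b.sum fun mu c => c • restrictedCasimirProd n r (fun i => 2 * mu.1 i) := by
    simp [Finsupp.sum, centeredCasimirProd, centeredCasimir, rhoShift_rhoUnshift,
      restrictedCasimirProd]
  rw [this]
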